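/- **Setting.** Let $d\ge 1$. For a grid size $\Delta x>0$ and $\alpha\in\mathbb Z^d$ put $x_\alpha=\alpha\,\Delta x\in\mathbb R^d$, and let $Z(\alpha)$ be the number of entries of $\alpha$ that are zero. For grid functions $u$ let $\nabla_+^j u_\alpha=(u_{\alpha+e_j}-u_\alpha)/\Delta x$, $\nabla_-^j u_\alpha=(u_\alpha-u_{\alpha-e_j})/\Delta x$, and for $F,G:\mathbb Z^d\times\mathbb Z^d\to\mathbb R$ let $(F\star G)_{\alpha,\beta}=\sum_{\eta\in\mathbb Z^d}F_{\alpha,\eta}G_{\eta,\beta}\,\Delta x^d$. For a kernel $K=K_{\alpha,\beta}(t)$, measurable in $t$, let $K^{(1)}=K$, $$K^{(m)}_{\alpha,\beta}(t)=\int_0^t\bigl(K(t-s)\star K^{(m-1)}(s)\bigr)_{\alpha,\beta}\,ds\quad(m\ge 2),\qquad \Phi_{\alpha,\beta}(t)=\sum_{m=1}^\infty K^{(m)}_{\alpha,\beta}(t).$$ For $C_1>0$ let $$f_{C_1}(t,\alpha)=\Bigl(1\wedge\frac{C_1t}{\Delta x^2}\Bigr)^{Z(\alpha)/2}t^{-1/2}\prod_{j=1}^d\tilde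 L(C_1t,\alpha^j\Delta x),\qquad \tilde L(t,z)=\frac1{\sqrt t}\Bigl(1+\frac{z^2}{t}\Bigr)^{-1}.$$ **(1)** For all $C,C_1>0$ there is $C_3>0$, depending only on $C,C_1,d$, such that for all $\Delta x,T>0$: if $|K_{\alpha,\beta}(t)|\le C f_{C_1}(t,\alpha-\beta)$ for all $t\in(0,T]$ and $\alpha,\beta\in\mathbb Z^d$, then all sums and integrals defining the $K^{(m)}$ on $(0,T]$ converge absolutely, and for all $m\ge1$, $t\in(0,T]$, $\alpha,\beta\in\mathbb Z^d$, $$|K^{(m)}_{\alpha,\beta}(t)|\le\frac{C\,C_3^m}{\Gamma(m/2)}\,t^{(m-1)/2}f_{C_1}(t,\alpha-\beta).$$ **(2)** For all $C,C_1,T>0$ there is $B>0$, depending only on $C,C_1,T,d$, such that for all $\Delta x>0$ and all $K$ as in (1): for all $\alpha,\beta$ the series $\sum_mK^{(m)}_{\alpha,\beta}$ converges absolutely in $L^1([0,T])$ and absolutely at every $t\in(0,T]$, its sum in $L^1([0,T])$ is $\Phi_{\alpha,\beta}$, and $|\Phi_{\alpha,\beta}(t)|\le B f_{C_1}(t,\alpha-\beta)$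 for all $t\in(0,T]$. **(3)** Let $0<\lambda\le\Lambda$ and $L\ge0$. Let $c=(c_\alpha^j)_{\alpha\in\mathbb Z^d,\,1\le j\le d}$ be any coefficients with $\lambda\le c^j_\alpha\le\Lambda$ and $|c^j_\alpha-c^j_\beta|\le L|x_\alpha-x_\beta|$ for all $\alpha,\beta,j$; put $\overline c=\sup_{\alpha,j}c_\alpha^j$. For each $\beta$ let $(t,\alpha)\mapsto a_{\alpha,\beta}(t)$ be the heat kernel with coefficients frozen at $\beta$, that is, the solution, bounded on $[0,S]\times\mathbb Z^d$ for every $S<\infty$ and continuous in $t\ge0$, of $\frac{d}{dt}a_{\alpha,\beta}=\sum_{j}c_\beta^j\nabla_+^j\nabla_-^ja_{\alpha,\beta}$ for $t>0$ (differences acting on $\alpha$), $a_{\alpha,\beta}(0)=\Delta x^{-d}\mathbf 1_{\{\alpha=0\}}$; such a solution exists. Let $K$ be the error kernel $$K_{\alpha,\beta}(t)=\sum_{j=1}^d\bigl(c_\alpha^j-c_\beta^j\bigr)\nabla_+^j\nabla_-^j\,a_{\alpha-\beta,\beta}(t).$$ Then, with constants $C,C_3>0$ that depend only on $d,\lambda,\Lambda,L$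 (in particular not on $\Delta x$), all sums and integrals defining the $K^{(m)}$ converge absolutely, and for all $m\ge1$, $t>0$, $\alpha,\beta$, $$|K^{(m)}_{\alpha,\beta}(t)|\le\frac{C\,C_3^m}{\Gamma(m/2)}\,t^{(m-1)/2}f_{2\overline c}(t,\alpha-\beta).$$ Moreover, for every $T>0$ and all $\alpha,\beta$ the series $\sum_mK^{(m)}_{\alpha,\beta}$ converges absolutely in $L^1([0,T])$ and absolutely at every $t\in(0,T]$, its sum in $L^1([0,T])$ is $\Phi_{\alpha,\beta}$, and there is a constant $B>0$ depending only on $d,\lambda,\Lambda,L,T$ (in particular not on $\Delta x,\alpha,\beta,t$) such that for all $t\in(0,T]$ and $\alpha,\beta\in\mathbb Z^d$ $$|\Phi_{\alpha,\beta}(t)|\le B\Bigl(\frac1{\sqrt{2\overline c}}\wedge\frac{t^{1/2}}{\Delta x}\Bigr)^{Z(\alpha-\beta)}t^{-(d+1)/2}\prod_{j=1}^d\Bigl(1+\frac{|x_\alpha^j-x_\beta^j|^2}{2\overline c\,t}\Bigr)^{-1}.$$ -/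

import Mathlib

open MeasureTheory Filter Topology

noncomputable section

/-- The grid point `x_α = α Δx` of the grid `Δx ℤ^d`, as a point of Euclidean space. -/
def gridPoint {d : ℕ} (Δx : ℝ) (α : Fin d → ℤ) : EuclideanSpace ℝ (Fin d) :=
  WithLp.toLp 2 (fun j => (α j : ℝ) * Δx)

/-- The number `Z(α)` of entries of the multi-index `α` that are zero. -/
def zeroCount {d : ℕ} (α : Fin d → ℤ) : ℕ :=
  (Finset.univ.filter (fun j => α j = 0)).card

/-- Forward difference `∇₊^j` on the grid. -/
def gridForwardDiff {d : ℕ} (Δx : ℝ) (j : Fin d) (u : (Fin d → ℤ) → ℝ) (α : Fin d → ℤ) : ℝ :=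
  (u (α + Pi.single j 1) - u α) / Δx

/-- Backward difference `∇₋^j` on the grid. -/
def gridBackwardDiff {d : ℕ} (Δx : ℝ) (j : Fin d) (u : (Fin d → ℤ) → ℝ) (α : Fin d → ℤ) : ℝ :=
  (u α - u (α - Pi.single j 1)) / Δx

/-- `a = a_α(t)` is the fundamental solution (heat kernel) of the semi-discrete heat equation
`da_α/dt = ∑_j c^j ∇₊^j ∇₋^j a_α` with constant coefficients `c^1, …, c^d` and initial data the
discrete Dirac mass `Δx^{-d} 1_{α = 0}`.  As usual, the infinite system is solved in the class of
functions that are bounded on `[0, S] × ℤ^d` for every finite `S`. -/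
structure IsSemiDiscreteHeatKernel {d : ℕ} (Δx : ℝ) (c : Fin d → ℝ)
    (a : ℝ → (Fin d → ℤ) → ℝ) : Prop where
  initial : ∀ α, a 0 α = if α = 0 then (Δx ^ d)⁻¹ else 0
  continuousOn : ∀ α, ContinuousOn (fun t => a t α) (Set.Ici 0)
  hasDerivAt : ∀ α, ∀ t : ℝ, 0 < t → HasDerivAt (fun s => a s α)
    (∑ j, c j * gridForwardDiff Δx j (gridBackwardDiff Δx j (a t)) α) t
  bounded : ∀ S : ℝ, 0 < S → ∃ M : ℝ, ∀ t ∈ Set.Icc 0 S, ∀ α, |a t α| ≤ M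

/-- The admissible coefficients: `lam ≤ c_α^j ≤ Lam`, and every `c^j` is Lipschitz on the grid
with constant `L`. -/
structure AdmissibleCoeff {d : ℕ} (Δx lam Lam L : ℝ) (c : (Fin d → ℤ) → Fin d → ℝ) : Prop where
  lower : ∀ α j, lam ≤ c α j
  upper : ∀ α j, c α j ≤ Lam
  lipschitz : ∀ α β j, |c α j - c β j| ≤ L * dist (gridPoint Δx α) (gridPoint Δx β)

/-- `c̄ = sup_{α, j} c_α^j`. -/
def coeffSup {d : ℕ} (c : (Fin d → ℤ) → Fin d → ℝ) : ℝ :=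
  ⨆ p : (Fin d → ℤ) × Fin d, c p.1 p.2

/-- A family `a = a_{α,β}(t)` (written `a t α β`) such that, for every frozen index `β`,
`(t, α) ↦ a_{α,β}(t)` is the heat kernel with the constant coefficients `c_β^1, …, c_β^d`. -/
def IsFrozenHeatKernel {d : ℕ} (Δx : ℝ) (c : (Fin d → ℤ) → Fin d → ℝ)
    (a : ℝ → (Fin d → ℤ) → (Fin d → ℤ) → ℝ) : Prop :=
  ∀ β, IsSemiDiscreteHeatKernel Δx (c β) (fun t α => a t α β)

/-- The error kernel of the frozen-coefficient approximation,
`K_{α,β}(t) = ∑_j (c_α^j - c_β^j) ∇₊^j ∇₋^j a_{α-β,β}(t)`, the differences acting on `α`. -/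
def errorKernel {d : ℕ} (Δx : ℝ) (c : (Fin d → ℤ) → Fin d → ℝ)
    (a : ℝ → (Fin d → ℤ) → (Fin d → ℤ) → ℝ) (t : ℝ) (α β : Fin d → ℤ) : ℝ :=
  ∑ j, (c α j - c β j) *
    gridForwardDiff Δx j (gridBackwardDiff Δx j (fun γ => a t (γ - β) β)) α

/-- The discrete convolution `(F ⋆ G)_{α,β} = ∑_η F_{α,η} G_{η,β} Δx^d`. -/
def gridConv {d : ℕ} (Δx : ℝ) (F G : (Fin d → ℤ) → (Fin d → ℤ) → ℝ) (α β : Fin d → ℤ) : ℝ :=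
  ∑' η, F α η * G η β * Δx ^ d

/-- The iterated space-time convolutions: `K^(1) = K` and
`K^(m)_{α,β}(t) = ∫_0^t (K(t-s) ⋆ K^(m-1)(s))_{α,β} ds` for `m ≥ 2`.
(The value at `m = 0` is not used.) -/
def iterKernel {d : ℕ} (Δx : ℝ) (K : ℝ → (Fin d → ℤ) → (Fin d → ℤ) → ℝ) :
    ℕ → ℝ → (Fin d → ℤ) → (Fin d → ℤ) → ℝ
  | 0 => fun _ _ _ => 0
  | 1 => K
  | (m + 2) => fun t α β => ∫ s in (0 : ℝ)..t, gridConv Δx (K (t - s)) (iterKernel Δx K (m + 1) s) α β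

/-- The Neumann series `Φ = ∑_{m ≥ 1} K^(m)`. -/
def neumannSum {d : ℕ} (Δx : ℝ) (K : ℝ → (Fin d → ℤ) → (Fin d → ℤ) → ℝ)
    (t : ℝ) (α β : Fin d → ℤ) : ℝ :=
  ∑' m : ℕ, iterKernel Δx K (m + 1) t α β

/-- All the convolutions that define the `K^(m)` on `(0, T]` make sense: the sums over the grid
converge absolutely and the time integrals are Lebesgue integrals of integrable functions. -/
def IterKernelWellDefined {d : ℕ} (Δx T : ℝ) (K : ℝ → (Fin d → ℤ) → (Fin d → ℤ) → ℝ) : Prop :=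
  ∀ m : ℕ, 1 ≤ m → ∀ t ∈ Set.Ioc 0 T, ∀ α β,
    (∀ s ∈ Set.Ioo 0 t, Summable (fun η => K (t - s) α η * iterKernel Δx K m s η β * Δx ^ d)) ∧
    IntervalIntegrable (fun s => gridConv Δx (K (t - s)) (iterKernel Δx K m s) α β) volume 0 t

/-- For all `α, β` the series `∑_{m ≥ 1} K^(m)_{α,β}` converges absolutely in `L¹([0, T])`, it
converges absolutely at every `t ∈ (0, T]`, and its pointwise sum is also its sum in `L¹`. -/
def NeumannSeriesConverges {d : ℕ} (Δx T : ℝ) (K : ℝ → (Fin d → ℤ) → (Fin d → ℤ) → ℝ) : Prop :=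
  ∀ α β,
    (∀ m : ℕ, 1 ≤ m → IntervalIntegrable (fun t => iterKernel Δx K m t α β) volume 0 T) ∧
    Summable (fun m : ℕ => ∫ t in (0 : ℝ)..T, |iterKernel Δx K (m + 1) t α β|) ∧
    (∀ t ∈ Set.Ioc 0 T, Summable (fun m : ℕ => |iterKernel Δx K (m + 1) t α β|)) ∧
    IntervalIntegrable (fun t => neumannSum Δx K t α β) volume 0 T ∧
    Tendsto (fun M : ℕ => ∫ t in (0 : ℝ)..T,
      |neumannSum Δx K t α β - ∑ m ∈ Finset.Icc 1 M, iterKernel Δx K m t α β|) atTop (𝓝 0)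

/-- The Lorentzian `L̃(t, z) = t^{-1/2} (1 + z²/t)^{-1}`. -/
def lorentzian (t z : ℝ) : ℝ := (1 / √t) * (1 + z ^ 2 / t)⁻¹

/-- The majorant
`f(t, α) = (1 ∧ C₁ t / Δx²)^{Z(α)/2} t^{-1/2} ∏_j L̃(C₁ t, α^j Δx)`. -/
def lorentzMajorant {d : ℕ} (C₁ Δx t : ℝ) (α : Fin d → ℤ) : ℝ :=
  (min 1 (C₁ * t / Δx ^ 2)) ^ ((zeroCount α : ℝ) / 2) * t ^ (-(1 / 2) : ℝ) *
    ∏ j, lorentzian (C₁ * t) ((α j : ℝ) * Δx)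

end

/-! The proof has two independent halves: a convolution calculus for the majorant, and a bound of
the error kernel by that majorant.

Convolution calculus. The prefactor involving Z(α) turns each diagonal Lorentzian 1/√τ into 1/√τ ∧
1/Δx, so f is t^(-1/2) times a product of one-dimensional cells at time τ = C₁t
(`lorentzMajorant_eq`). The cap 1/Δx keeps the discrete mass of a cell at most 5, uniformly in Δx
and τ. Convolving cells of times τ₁ and τ₂ gives at most 80 times the cell of time τ₁ + τ₂
(`sum_lorentzCell_mul_le`): at every intermediate point one of the two factors is already dominated
by the target cell, and the other one is summed. In a space-time convolution the times C₁(t-s) and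
C₁s add up to C₁t, so the spatial factor leaves the time integral and only a Beta integral remains.
Its Gamma factors cancel along the induction (`LorentzBounded.iterKernel`), leaving 1/Γ(m/2), which
beats every geometric rate and makes the Neumann series converge.

Error kernel. Bounded solutions of the frozen equation are unique, hence equal to a product of
rescaled heat kernels of ℤ. These are Fourier integrals of exp(-s(2 - 2cos θ)); integration by parts
converts powers of k into trigonometric multipliers, and the moments of |θ|^n are O(s^(-(n+1)/2)),
so polynomial decay of Lorentzian type follows (`exists_heatFourier_bounds`). A second difference
costs 1/t, while the Lipschitz factor supplies a distance worth √t; the product is the weight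
t^(-1/2) of the majorant (`exists_errorKernel_bound`). -/

noncomputable section

/-- The one-dimensional factor of the Lorentzian majorant: `√τ / (τ + (k h)²)` off the diagonal,
and `1/√τ ∧ 1/h` on it. -/
def lorentzCell (h τ : ℝ) (k : ℤ) : ℝ :=
  if k = 0 then min (1 / √τ) (1 / h) else √τ / (τ + ((k : ℝ) * h) ^ 2)

/-! ### One-dimensional cells: uniform mass and approximate semigroup property. -/

section cell
variable {h τ : ℝ}

theorem lorentzCell_zero : lorentzCell h τ 0 = min (1 / √τ) (1 / h) := by simp [lorentzCell]

theorem lorentzCell_of_ne {k : ℤ} (hk : k ≠ 0) :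
    lorentzCell h τ k = √τ / (τ + ((k : ℝ) * h) ^ 2) := by simp [lorentzCell, hk]

theorem lorentzCell_pos (hh : 0 < h) (hτ : 0 < τ) (k : ℤ) : 0 < lorentzCell h τ k := by
  unfold lorentzCell
  split_ifs <;> positivity

theorem one_le_intCast_sq {k : ℤ} (hk : k ≠ 0) : (1 : ℝ) ≤ (k : ℝ) ^ 2 := by
  have : (1 : ℤ) ≤ k ^ 2 := by
    have := sq_nonneg k
    have h2 : k ^ 2 ≠ 0 := pow_ne_zero 2 hk
    omega
  exact_mod_cast this

theorem lorentzCell_le_inv_sqrt (hh : 0 < h) (hτ : 0 < τ) (k : ℤ) :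
    lorentzCell h τ k ≤ 1 / √τ := by
  by_cases hk : k = 0
  · subst hk; rw [lorentzCell_zero]; exact min_le_left _ _
  · rw [lorentzCell_of_ne hk, div_le_div_iff₀ (by positivity) (by positivity),
      Real.mul_self_sqrt hτ.le]
    nlinarith [sq_nonneg ((k : ℝ) * h)]

theorem lorentzCell_le_inv (hh : 0 < h) (hτ : 0 < τ) (k : ℤ) : lorentzCell h τ k ≤ 1 / h := by
  by_cases hk : k = 0
  · subst hk; rw [lorentzCell_zero]; exact min_le_right _ _
  · rw [lorentzCell_of_ne hk, div_le_div_iff₀ (by positivity) (by positivity)]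
    have h1 := one_le_intCast_sq hk
    have h2 := Real.sq_sqrt hτ.le
    have h3 : h ^ 2 * 1 ≤ h ^ 2 * (k : ℝ) ^ 2 := by gcongr
    nlinarith [sq_nonneg (√τ - h)]

theorem lorentzCell_le_zero (hh : 0 < h) (hτ : 0 < τ) (k : ℤ) :
    lorentzCell h τ k ≤ lorentzCell h τ 0 := by
  rw [lorentzCell_zero]
  exact le_min (lorentzCell_le_inv_sqrt hh hτ k) (lorentzCell_le_inv hh hτ k)

theorem lorentzCell_neg (k : ℤ) : lorentzCell h τ (-k) = lorentzCell h τ k := by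
  simp [lorentzCell]

/-- The numerator and the cap only increase with time, while denominators grow by at most the ratio
r of the times. -/
theorem lorentzCell_mono_time {τ' : ℝ} (hh : 0 < h) (hτ : 0 < τ) (hle : τ ≤ τ') {r : ℝ}
    (hr : τ' ≤ r * τ) (k : ℤ) : lorentzCell h τ k ≤ r * lorentzCell h τ' k := by
  have hτ' : 0 < τ' := hτ.trans_le hle
  have hr1 : 1 ≤ r := by
    by_contra hcon
    push Not at hcon
    nlinarith
  have hs : √τ ≤ √τ' := Real.sqrt_le_sqrt hle
  have hs1 : √τ' ≤ r * √τ := by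
    rw [Real.sqrt_le_left (by positivity), mul_pow, Real.sq_sqrt hτ.le]
    nlinarith [mul_pos hτ (by linarith : 0 < r)]
  by_cases hk : k = 0
  · subst hk
    rw [lorentzCell_zero, lorentzCell_zero, mul_min_of_nonneg _ _ (by linarith)]
    refine min_le_min ?_ ?_
    · rw [mul_one_div, div_le_div_iff₀ (by positivity) (by positivity)]
      linarith
    · have : 0 < 1 / h := by positivity
      nlinarith
  · rw [lorentzCell_of_ne hk, lorentzCell_of_ne hk, mul_div_assoc',
      div_le_div_iff₀ (by positivity) (by positivity)]
    have hx := sq_nonneg ((k : ℝ) * h)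
    calc √τ * (τ' + ((k : ℝ) * h) ^ 2) ≤ √τ' * (r * (τ + ((k : ℝ) * h) ^ 2)) := by
          gcongr
          nlinarith
      _ = _ := by ring

/-- Discrete form of integrating √τ/(√τ + x)², whose primitive is explicit; the factor 2 comes from
(√τ + x)² ≤ 2(τ + x²). -/
theorem lorentzCell_mul_le_telescope (hh : 0 < h) (hτ : 0 < τ) (n : ℕ) :
    lorentzCell h τ ((n : ℤ) + 1) * h ≤
      2 * (√τ / (√τ + n * h) - √τ / (√τ + (n + 1) * h)) := by
  rw [lorentzCell_of_ne (by omega)]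
  have hs : 0 < √τ := by positivity
  have h2 := Real.sq_sqrt hτ.le
  push_cast
  rw [div_sub_div _ _ (by positivity) (by positivity), div_mul_eq_mul_div, mul_div_assoc',
    div_le_div_iff₀ (by positivity) (by positivity)]
  have key : (√τ + n * h) * (√τ + (n + 1) * h) ≤ 2 * (τ + ((n + 1) * h) ^ 2) := by
    have hn : (0 : ℝ) ≤ n := n.cast_nonneg
    have : √τ + n * h ≤ √τ + (n + 1) * h := by nlinarith
    calc (√τ + n * h) * (√τ + (n + 1) * h) ≤ (√τ + (n + 1) * h) * (√τ + (n + 1) * h) := by gcongr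
      _ ≤ _ := by nlinarith [sq_nonneg (√τ - (n + 1) * h)]
  have hp : 0 ≤ √τ * h := by positivity
  nlinarith [mul_le_mul_of_nonneg_left key hp]

/-- The diagonal contributes at most 1 because of the cap 1/h; each of the two tails telescopes to
at most 2. -/
theorem sum_Icc_lorentzCell_le (hh : 0 < h) (hτ : 0 < τ) (n : ℕ) :
    ∑ k ∈ Finset.Icc (-(n : ℤ)) n, lorentzCell h τ k * h ≤
      1 + 4 * (1 - √τ / (√τ + n * h)) := by
  have hs : 0 < √τ := by positivity
  induction n with
  | zero =>
    have := lorentzCell_le_inv hh hτ 0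
    rw [le_div_iff₀ hh] at this
    simp [div_self hs.ne', this]
  | succ n ih =>
    have hI : Finset.Icc (-((n + 1 : ℕ) : ℤ)) ((n + 1 : ℕ) : ℤ) =
        insert ((n : ℤ) + 1) (insert (-((n : ℤ) + 1)) (Finset.Icc (-(n : ℤ)) n)) := by
      ext x; simp only [Finset.mem_Icc, Finset.mem_insert]; push_cast; omega
    rw [hI, Finset.sum_insert, Finset.sum_insert, lorentzCell_neg]
    · have := lorentzCell_mul_le_telescope hh hτ n
      push_cast
      linarith
    · simp
    · simp only [Finset.mem_insert, Finset.mem_Icc]; omega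

theorem sum_lorentzCell_le (hh : 0 < h) (hτ : 0 < τ) (S : Finset ℤ) :
    ∑ k ∈ S, lorentzCell h τ k * h ≤ 5 := by
  obtain ⟨n, hn⟩ : ∃ n : ℕ, S ⊆ Finset.Icc (-(n : ℤ)) n := by
    refine ⟨S.sup Int.natAbs, fun x hx => ?_⟩
    have : x.natAbs ≤ S.sup Int.natAbs := Finset.le_sup (f := Int.natAbs) hx
    rw [Finset.mem_Icc]; omega
  calc _ ≤ ∑ k ∈ Finset.Icc (-(n : ℤ)) n, lorentzCell h τ k * h :=
        Finset.sum_le_sum_of_subset_of_nonneg hn fun k _ _ =>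
          mul_nonneg (lorentzCell_pos hh hτ k).le hh.le
    _ ≤ _ := sum_Icc_lorentzCell_le hh hτ n
    _ ≤ 5 := by
      have : 0 ≤ √τ / (√τ + n * h) := by positivity
      linarith

theorem sum_lorentzCell_comp_le (hh : 0 < h) (hτ : 0 < τ) (S : Finset ℤ) (e : ℤ → ℤ)
    (he : Function.Injective e) : ∑ k ∈ S, lorentzCell h τ (e k) * h ≤ 5 := by
  have := sum_lorentzCell_le hh hτ (S.map ⟨e, he⟩)
  simpa using this

/-- Tail regime: √τ increases with τ, and since |n| ≥ |a|/2 the target denominator τ' + (ah)² ≤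
2(ah)² is at most 8(nh)². -/
theorem lorentzCell_le_of_two_mul_abs_le {τ' : ℝ} (hh : 0 < h) (hτ : 0 < τ) (hle : τ ≤ τ')
    {a n : ℤ} (ha : a ≠ 0) (han : a ^ 2 ≤ 4 * n ^ 2) (hbig : τ' ≤ ((a : ℝ) * h) ^ 2) :
    lorentzCell h τ n ≤ 8 * lorentzCell h τ' a := by
  have hn : n ≠ 0 := by
    rintro rfl
    have : 0 < a ^ 2 := by positivity
    omega
  have hτ' : 0 < τ' := hτ.trans_le hle
  have han' : (a : ℝ) ^ 2 ≤ 4 * (n : ℝ) ^ 2 := by exact_mod_cast han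
  have h1 : ((a : ℝ) * h) ^ 2 ≤ 4 * ((n : ℝ) * h) ^ 2 := by
    rw [mul_pow, mul_pow]; nlinarith [sq_nonneg h]
  rw [lorentzCell_of_ne hn, lorentzCell_of_ne ha, mul_div_assoc',
    div_le_div_iff₀ (by positivity) (by positivity)]
  have hs : √τ ≤ √τ' := Real.sqrt_le_sqrt hle
  calc √τ * (τ' + ((a : ℝ) * h) ^ 2) ≤ √τ' * (8 * (τ + ((n : ℝ) * h) ^ 2)) := by
        gcongr
        nlinarith
    _ = _ := by ring

/-- In the tail of the target cell, one of the two displacements is at least half of m + n, and that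
factor is small enough. Near the centre the factor with the larger time works, because its time is
at least half of the total. -/
theorem lorentzCell_le_or {τ₁ τ₂ : ℝ} (hh : 0 < h) (h₁ : 0 < τ₁) (h₂ : 0 < τ₂) (m n : ℤ) :
    lorentzCell h τ₁ m ≤ 8 * lorentzCell h (τ₁ + τ₂) (m + n) ∨
      lorentzCell h τ₂ n ≤ 8 * lorentzCell h (τ₁ + τ₂) (m + n) := by
  wlog hle : τ₂ ≤ τ₁ generalizing τ₁ τ₂ m n
  · have := this h₂ h₁ n m (by linarith)
    rw [add_comm τ₁, add_comm m]
    exact this.symm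
  have hsum : 0 < τ₁ + τ₂ := by linarith
  by_cases ha : m + n = 0
  · left
    have h1 := lorentzCell_mono_time hh h₁ (by linarith : τ₁ ≤ τ₁ + τ₂) (r := 2) (by linarith) 0
    have h2 := lorentzCell_pos hh hsum 0
    have h3 := lorentzCell_le_zero hh h₁ m
    rw [ha]
    linarith
  by_cases hbig : τ₁ + τ₂ ≤ (((m + n : ℤ) : ℝ) * h) ^ 2
  · by_cases hn : (m + n) ^ 2 ≤ 4 * n ^ 2
    · right
      exact lorentzCell_le_of_two_mul_abs_le hh h₂ (by linarith) ha hn hbig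
    · left
      exact lorentzCell_le_of_two_mul_abs_le hh h₁ (by linarith) ha
        (by nlinarith [sq_nonneg (m - n)]) hbig
  · left
    refine (lorentzCell_le_inv_sqrt hh h₁ m).trans ?_
    rw [lorentzCell_of_ne ha, mul_div_assoc', div_le_div_iff₀ (by positivity) (by positivity)]
    have hs : √τ₁ ≤ √(τ₁ + τ₂) := Real.sqrt_le_sqrt (by linarith)
    have e1 := Real.sq_sqrt h₁.le
    nlinarith [mul_le_mul_of_nonneg_right hs (Real.sqrt_nonneg τ₁)]

/-- By the dichotomy, a product XY of two cells is at most 8Z(X + Y) with Z the target cell; summing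
X and Y separately gives 80 = 8·(5 + 5). -/
theorem sum_lorentzCell_mul_le {τ₁ τ₂ : ℝ} (hh : 0 < h) (h₁ : 0 < τ₁) (h₂ : 0 < τ₂) (a b : ℤ)
    (S : Finset ℤ) :
    ∑ k ∈ S, lorentzCell h τ₁ (a - k) * lorentzCell h τ₂ (k - b) * h ≤
      80 * lorentzCell h (τ₁ + τ₂) (a - b) := by
  have hc := lorentzCell_pos hh (add_pos h₁ h₂) (a - b)
  have key : ∀ k, lorentzCell h τ₁ (a - k) * lorentzCell h τ₂ (k - b) * h ≤
      8 * lorentzCell h (τ₁ + τ₂) (a - b) *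
        (lorentzCell h τ₁ (a - k) * h + lorentzCell h τ₂ (k - b) * h) := by
    intro k
    have p1 := lorentzCell_pos hh h₁ (a - k)
    have p2 := lorentzCell_pos hh h₂ (k - b)
    have := lorentzCell_le_or hh h₁ h₂ (a - k) (k - b)
    rw [sub_add_sub_cancel] at this
    set X := lorentzCell h τ₁ (a - k)
    set Y := lorentzCell h τ₂ (k - b)
    set Z := lorentzCell h (τ₁ + τ₂) (a - b)
    have hX := mul_pos p1 hh
    have hY := mul_pos p2 hh
    rcases this with h' | h'
    · nlinarith [mul_le_mul_of_nonneg_right h' hY.le, mul_pos hc hX]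
    · nlinarith [mul_le_mul_of_nonneg_right h' hX.le, mul_pos hc hY]
  refine (Finset.sum_le_sum fun k _ => key k).trans ?_
  rw [← Finset.mul_sum, Finset.sum_add_distrib]
  have s1 := sum_lorentzCell_comp_le hh h₁ S (fun k => a - k) (fun x y hxy => by simpa using hxy)
  have s2 := sum_lorentzCell_comp_le hh h₂ S (fun k => k - b) (fun x y hxy => by simpa using hxy)
  have := mul_le_mul_of_nonneg_left (add_le_add s1 s2)
    (by positivity : 0 ≤ 8 * lorentzCell h (τ₁ + τ₂) (a - b))
  linarith

end cell

/-! ### Product cells in dimension d and their identification with the majorant. -/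

section grid
variable {d : ℕ} {h : ℝ}

/-- The spatial part `∏_j lorentzCell h τ α^j` of the Lorentzian majorant. -/
def lorentzProd (h τ : ℝ) (α : Fin d → ℤ) : ℝ := ∏ j, lorentzCell h τ (α j)

theorem lorentzProd_pos {τ : ℝ} (hh : 0 < h) (hτ : 0 < τ) (α : Fin d → ℤ) :
    0 < lorentzProd h τ α :=
  Finset.prod_pos fun j _ => lorentzCell_pos hh hτ (α j)

theorem lorentzProd_le_inv_pow {τ : ℝ} (hh : 0 < h) (hτ : 0 < τ) (α : Fin d → ℤ) :
    lorentzProd h τ α ≤ (1 / h) ^ d := by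
  calc lorentzProd h τ α ≤ ∏ _j : Fin d, (1 / h) :=
        Finset.prod_le_prod (fun j _ => (lorentzCell_pos hh hτ (α j)).le)
          fun j _ => lorentzCell_le_inv hh hτ (α j)
    _ = _ := by simp

/-- Enlarging S to the box spanned by its coordinate projections makes the sum factor into d
one-dimensional convolutions. -/
theorem sum_lorentzProd_mul_le {τ₁ τ₂ : ℝ} (hh : 0 < h) (h₁ : 0 < τ₁) (h₂ : 0 < τ₂)
    (α β : Fin d → ℤ) (S : Finset (Fin d → ℤ)) :
    ∑ η ∈ S, lorentzProd h τ₁ (α - η) * lorentzProd h τ₂ (η - β) * h ^ d ≤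
      80 ^ d * lorentzProd h (τ₁ + τ₂) (α - β) := by
  have hterm : ∀ η : Fin d → ℤ,
      lorentzProd h τ₁ (α - η) * lorentzProd h τ₂ (η - β) * h ^ d =
        ∏ j, (lorentzCell h τ₁ (α j - η j) * lorentzCell h τ₂ (η j - β j) * h) := by
    intro η
    simp [lorentzProd, Finset.prod_mul_distrib]
  have hnn : ∀ (j : Fin d) (k : ℤ),
      0 ≤ lorentzCell h τ₁ (α j - k) * lorentzCell h τ₂ (k - β j) * h := fun j k =>
    mul_nonneg (mul_nonneg (lorentzCell_pos hh h₁ _).le (lorentzCell_pos hh h₂ _).le) hh.le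
  calc _ ≤ ∑ η ∈ Fintype.piFinset (fun j => S.image fun η => η j),
        lorentzProd h τ₁ (α - η) * lorentzProd h τ₂ (η - β) * h ^ d := by
        refine Finset.sum_le_sum_of_subset_of_nonneg (fun η hη => ?_) fun η _ _ => ?_
        · rw [Fintype.mem_piFinset]
          exact fun j => Finset.mem_image_of_mem _ hη
        · rw [hterm]; exact Finset.prod_nonneg fun j _ => hnn j _
    _ = ∏ j, ∑ k ∈ S.image (fun η => η j),
          (lorentzCell h τ₁ (α j - k) * lorentzCell h τ₂ (k - β j) * h) := by
        rw [Finset.prod_univ_sum]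
        exact Finset.sum_congr rfl fun η _ => hterm η
    _ ≤ ∏ j, (80 * lorentzCell h (τ₁ + τ₂) (α j - β j)) :=
        Finset.prod_le_prod (fun j _ => Finset.sum_nonneg fun k _ => hnn j k)
          fun j _ => sum_lorentzCell_mul_le hh h₁ h₂ _ _ _
    _ = _ := by simp [lorentzProd, Finset.prod_mul_distrib]

theorem summable_lorentzProd_mul {τ₁ τ₂ : ℝ} (hh : 0 < h) (h₁ : 0 < τ₁) (h₂ : 0 < τ₂)
    (α β : Fin d → ℤ) :
    Summable fun η => lorentzProd h τ₁ (α - η) * lorentzProd h τ₂ (η - β) * h ^ d :=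
  summable_of_sum_le (fun η => mul_nonneg (mul_nonneg (lorentzProd_pos hh h₁ _).le
    (lorentzProd_pos hh h₂ _).le) (by positivity)) (sum_lorentzProd_mul_le hh h₁ h₂ α β)

theorem tsum_lorentzProd_mul_le {τ₁ τ₂ : ℝ} (hh : 0 < h) (h₁ : 0 < τ₁) (h₂ : 0 < τ₂)
    (α β : Fin d → ℤ) :
    ∑' η, lorentzProd h τ₁ (α - η) * lorentzProd h τ₂ (η - β) * h ^ d ≤
      80 ^ d * lorentzProd h (τ₁ + τ₂) (α - β) :=
  (summable_lorentzProd_mul hh h₁ h₂ α β).tsum_le_of_sum_le (sum_lorentzProd_mul_le hh h₁ h₂ α β)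

theorem lorentzian_eq_div {τ z : ℝ} (hτ : 0 < τ) : lorentzian τ z = √τ / (τ + z ^ 2) := by
  unfold lorentzian
  have h2 := Real.sq_sqrt hτ.le
  have hs : 0 < √τ := by positivity
  rw [one_div, ← mul_inv, ← one_div, div_eq_div_iff (by positivity) (by positivity)]
  field_simp
  rw [h2]

theorem sqrt_min_mul_lorentzian_zero {τ : ℝ} (hh : 0 < h) (hτ : 0 < τ) :
    √(min 1 (τ / h ^ 2)) * lorentzian τ 0 = lorentzCell h τ 0 := by
  have hs : 0 < √τ := by positivity
  have h1 : lorentzian τ 0 = 1 / √τ := by simp [lorentzian]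
  have h2 : √(min 1 (τ / h ^ 2)) = min 1 (√τ / h) := by
    rw [Real.sqrt_monotone.map_min, Real.sqrt_one, Real.sqrt_div hτ.le, Real.sqrt_sq hh.le]
  rw [h1, h2, lorentzCell_zero, min_mul_of_nonneg _ _ (by positivity)]
  congr 1
  · ring
  · field_simp

theorem pow_zeroCount_mul_prod (x : ℝ) (α : Fin d → ℤ) (f : Fin d → ℝ) :
    x ^ zeroCount α * ∏ j, f j = ∏ j, ((if α j = 0 then x else 1) * f j) := by
  rw [Finset.prod_mul_distrib, Finset.prod_ite, Finset.prod_const, Finset.prod_const_one, mul_one]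
  rfl

theorem rpow_half_natCast {x : ℝ} (hx : 0 ≤ x) (n : ℕ) : x ^ ((n : ℝ) / 2) = √x ^ n := by
  rw [Real.sqrt_eq_rpow, ← Real.rpow_natCast, ← Real.rpow_mul hx]
  congr 1; ring

/-- The power Z(α)/2 hands one factor √(1 ∧ C₁t/h²) to each vanishing coordinate, where it produces
the cap of the cell. -/
theorem lorentzMajorant_eq {C₁ t : ℝ} (hC : 0 < C₁) (hh : 0 < h) (ht : 0 < t) (α : Fin d → ℤ) :
    lorentzMajorant C₁ h t α = t ^ (-(1 / 2) : ℝ) * lorentzProd h (C₁ * t) α := by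
  have hτ : 0 < C₁ * t := mul_pos hC ht
  unfold lorentzMajorant lorentzProd
  rw [rpow_half_natCast (by positivity), mul_right_comm, pow_zeroCount_mul_prod, mul_comm]
  congr 1
  refine Finset.prod_congr rfl fun j _ => ?_
  split_ifs with hj
  · simp only [hj, Int.cast_zero, zero_mul]
    exact sqrt_min_mul_lorentzian_zero hh hτ
  · rw [one_mul, lorentzian_eq_div hτ, lorentzCell_of_ne hj]

end grid

/-! ### The Beta integral in real form. -/

theorem integral_rpow_mul_sub_rpow {x y t : ℝ} (hx : 0 < x) (hy : 0 < y) (ht : 0 < t) :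
    ∫ s in (0 : ℝ)..t, s ^ (x - 1) * (t - s) ^ (y - 1) =
      t ^ (x + y - 1) * (Real.Gamma x * Real.Gamma y / Real.Gamma (x + y)) := by
  have h1 := Complex.betaIntegral_scaled x y ht
  rw [Complex.betaIntegral_eq_Gamma_mul_div _ _ (by simpa) (by simpa)] at h1
  have h2 : ∫ s in (0 : ℝ)..t, (s : ℂ) ^ ((x : ℂ) - 1) * ((t : ℂ) - s) ^ ((y : ℂ) - 1) =
      ((∫ s in (0 : ℝ)..t, s ^ (x - 1) * (t - s) ^ (y - 1) : ℝ) : ℂ) := by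
    rw [← intervalIntegral.integral_ofReal]
    refine intervalIntegral.integral_congr fun s hs => ?_
    rw [Set.uIcc_of_le ht.le] at hs
    rw [Complex.ofReal_mul, Complex.ofReal_cpow hs.1, Complex.ofReal_cpow (by linarith [hs.2])]
    push_cast
    rfl
  rw [h2] at h1
  have h3 : ((t ^ (x + y - 1) * (Real.Gamma x * Real.Gamma y / Real.Gamma (x + y)) : ℝ) : ℂ) =
      (t : ℂ) ^ ((x : ℂ) + y - 1) *
        (Complex.Gamma x * Complex.Gamma y / Complex.Gamma (x + y)) := by
    rw [Complex.ofReal_mul, Complex.ofReal_cpow ht.le, Complex.ofReal_div, Complex.ofReal_mul,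
      ← Complex.Gamma_ofReal, ← Complex.Gamma_ofReal, ← Complex.Gamma_ofReal]
    push_cast
    rfl
  rw [← h3] at h1
  exact_mod_cast h1

/-- A non-integrable function has integral 0 by convention, whereas the Beta value is positive. -/
theorem intervalIntegrable_rpow_mul_sub_rpow {x y t : ℝ} (hx : 0 < x) (hy : 0 < y) (ht : 0 < t) :
    IntervalIntegrable (fun s => s ^ (x - 1) * (t - s) ^ (y - 1)) volume 0 t := by
  apply intervalIntegral.intervalIntegrable_of_integral_ne_zero
  rw [integral_rpow_mul_sub_rpow hx hy ht]
  have := Real.Gamma_pos_of_pos hx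
  have := Real.Gamma_pos_of_pos hy
  have := Real.Gamma_pos_of_pos (add_pos hx hy)
  positivity

/-! ### Space-time convolution of dominated kernels. -/

section conv
variable {d : ℕ}

/-- A space-time kernel that is measurable in time and dominated on `(0, T]` by
`D t^(x-1) ∏_j lorentzCell h (C₁ t) (α^j - β^j)`. -/
structure LorentzBounded (h T C₁ D x : ℝ) (P : ℝ → (Fin d → ℤ) → (Fin d → ℤ) → ℝ) : Prop where
  aemeasurable : ∀ α β, AEMeasurable (fun t => P t α β) (volume.restrict (Set.Ioc 0 T))
  bound : ∀ t ∈ Set.Ioc 0 T, ∀ α β,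
    |P t α β| ≤ D * t ^ (x - 1) * lorentzProd h (C₁ * t) (α - β)

/-- The space-time convolution `∫_0^t K(t-s) ⋆ P(s) ds`. -/
def spaceTimeConv (h : ℝ) (K P : ℝ → (Fin d → ℤ) → (Fin d → ℤ) → ℝ) (t : ℝ)
    (α β : Fin d → ℤ) : ℝ :=
  ∫ s in (0 : ℝ)..t, gridConv h (K (t - s)) (P s) α β

/-- The integrand of `spaceTimeConv` for kernels that are set to zero outside `(0, T]`. -/
def truncConv (h T : ℝ) (K P : ℝ → (Fin d → ℤ) → (Fin d → ℤ) → ℝ) (α β : Fin d → ℤ)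
    (t s : ℝ) : ℝ :=
  ∑' η, (Set.Ioc 0 T).indicator (fun r => K r α η) (t - s) *
    (Set.Ioc 0 T).indicator (fun r => P r η β) s * h ^ d

variable {h T C₁ C D x : ℝ} {K P : ℝ → (Fin d → ℤ) → (Fin d → ℤ) → ℝ}

theorem truncConv_eq_gridConv {t s : ℝ} (ht : t ≤ T) (hs : s ∈ Set.Ioo 0 t) (α β : Fin d → ℤ) :
    truncConv h T K P α β t s = gridConv h (K (t - s)) (P s) α β := by
  unfold truncConv gridConv
  have h1 : s ∈ Set.Ioc 0 T := ⟨hs.1, hs.2.le.trans ht⟩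
  have h2 : t - s ∈ Set.Ioc 0 T := ⟨by linarith [hs.2], by linarith [hs.1]⟩
  simp_rw [Set.indicator_of_mem h1, Set.indicator_of_mem h2]

/-- This lets the integral over (0, t) be written over the whole line, so that the domain no longer
depends on t and measurability in t follows from Fubini. -/
theorem truncConv_eq_zero {t s : ℝ} (hs : s ∉ Set.Ioo 0 t) (α β : Fin d → ℤ) :
    truncConv h T K P α β t s = 0 := by
  unfold truncConv
  convert tsum_zero with η
  by_cases h0 : 0 < s
  · have : t - s ∉ Set.Ioc 0 T := fun hm => hs ⟨h0, by linarith [hm.1]⟩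
    simp [Set.indicator_of_notMem this]
  · have : s ∉ Set.Ioc 0 T := fun hm => h0 hm.1
    simp [Set.indicator_of_notMem this]

theorem LorentzBounded.aemeasurable_indicator (hK : LorentzBounded h T C₁ C x K)
    (α β : Fin d → ℤ) : AEMeasurable ((Set.Ioc 0 T).indicator fun r => K r α β) :=
  (aemeasurable_indicator_iff measurableSet_Ioc).2 (hK.aemeasurable α β)

variable {y : ℝ}

theorem aemeasurable_truncConv (hK : LorentzBounded h T C₁ C y K) (hP : LorentzBounded h T C₁ D x P)
    (α β : Fin d → ℤ) (t : ℝ) : AEMeasurable (truncConv h T K P α β t) := by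
  unfold truncConv
  refine AEMeasurable.tsum fun η => ?_
  exact (((hK.aemeasurable_indicator α η).comp_quasiMeasurePreserving
    (quasiMeasurePreserving_sub_left volume t)).mul (hP.aemeasurable_indicator η β)).mul_const _

/-- Each summand is, in (t, s), the integrand of a convolution on ℝ, for which joint a.e.
measurability is known. -/
theorem aemeasurable_truncConv_prod (hK : LorentzBounded h T C₁ C y K)
    (hP : LorentzBounded h T C₁ D x P) (α β : Fin d → ℤ) :
    AEMeasurable (fun p : ℝ × ℝ => truncConv h T K P α β p.1 p.2) (volume.prod volume) := by
  unfold truncConv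
  refine AEMeasurable.tsum fun η => AEMeasurable.mul_const ?_ _
  have := AEStronglyMeasurable.convolution_integrand (ContinuousLinearMap.mul ℝ ℝ)
    (hP.aemeasurable_indicator η β).aestronglyMeasurable
    (hK.aemeasurable_indicator α η).aestronglyMeasurable
  refine this.aemeasurable.congr (Eventually.of_forall fun p => ?_)
  simp [mul_comm]

theorem spaceTimeConv_eq_integral_truncConv {t : ℝ} (ht : t ∈ Set.Ioc 0 T) (α β : Fin d → ℤ) :
    spaceTimeConv h K P t α β = ∫ s, truncConv h T K P α β t s := by
  unfold spaceTimeConv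
  rw [intervalIntegral.integral_of_le ht.1.le, integral_Ioc_eq_integral_Ioo,
    ← setIntegral_eq_integral_of_forall_compl_eq_zero
      (fun s hs => truncConv_eq_zero hs α β)]
  exact setIntegral_congr_fun measurableSet_Ioo fun s hs =>
    (truncConv_eq_gridConv ht.2 hs α β).symm

theorem abs_mul_mul_pow_le (hh : 0 < h) (hK : LorentzBounded h T C₁ C y K)
    (hP : LorentzBounded h T C₁ D x P) {t s : ℝ} (ht : t ≤ T) (hs : s ∈ Set.Ioo 0 t)
    (α η β : Fin d → ℤ) :
    ‖K (t - s) α η * P s η β * h ^ d‖ ≤ (C * D * (s ^ (x - 1) * (t - s) ^ (y - 1))) *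
      (lorentzProd h (C₁ * (t - s)) (α - η) * lorentzProd h (C₁ * s) (η - β) * h ^ d) := by
  have h1 := hK.bound (t - s) ⟨by linarith [hs.2], by linarith [hs.1]⟩ α η
  have h2 := hP.bound s ⟨hs.1, hs.2.le.trans ht⟩ η β
  rw [Real.norm_eq_abs, abs_mul, abs_mul, abs_of_pos (pow_pos hh d)]
  calc _ ≤ (C * (t - s) ^ (y - 1) * lorentzProd h (C₁ * (t - s)) (α - η)) *
        (D * s ^ (x - 1) * lorentzProd h (C₁ * s) (η - β)) * h ^ d := by
        gcongr
        exact (abs_nonneg _).trans h1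
    _ = _ := by ring

theorem summable_gridConv (hh : 0 < h) (hC₁ : 0 < C₁) (hK : LorentzBounded h T C₁ C y K)
    (hP : LorentzBounded h T C₁ D x P) {t s : ℝ} (ht : t ≤ T) (hs : s ∈ Set.Ioo 0 t)
    (α β : Fin d → ℤ) : Summable fun η => K (t - s) α η * P s η β * h ^ d :=
  Summable.of_norm_bounded
    ((summable_lorentzProd_mul hh (mul_pos hC₁ (by linarith [hs.2])) (mul_pos hC₁ hs.1)
      α β).mul_left _) (fun η => abs_mul_mul_pow_le hh hK hP ht hs α η β)

/-- The spatial factor on the right does not depend on s, because the two cell times add up to C₁t.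
-/
theorem norm_gridConv_le (hh : 0 < h) (hC₁ : 0 < C₁) (hC : 0 ≤ C) (hD : 0 ≤ D)
    (hK : LorentzBounded h T C₁ C y K) (hP : LorentzBounded h T C₁ D x P) {t s : ℝ} (ht : t ≤ T)
    (hs : s ∈ Set.Ioo 0 t) (α β : Fin d → ℤ) :
    ‖gridConv h (K (t - s)) (P s) α β‖ ≤ C * D * 80 ^ d * lorentzProd h (C₁ * t) (α - β) *
      (s ^ (x - 1) * (t - s) ^ (y - 1)) := by
  have h1 : 0 < C₁ * (t - s) := mul_pos hC₁ (by linarith [hs.2])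
  have h2 : 0 < C₁ * s := mul_pos hC₁ hs.1
  have hsum := (summable_lorentzProd_mul hh h1 h2 α β).mul_left
    (C * D * (s ^ (x - 1) * (t - s) ^ (y - 1)))
  refine (tsum_of_norm_bounded hsum.hasSum
    (fun η => abs_mul_mul_pow_le hh hK hP ht hs α η β)).trans ?_
  rw [tsum_mul_left]
  have h3 := tsum_lorentzProd_mul_le hh h1 h2 α β
  rw [show C₁ * (t - s) + C₁ * s = C₁ * t by ring] at h3
  have h4 : 0 ≤ C * D * (s ^ (x - 1) * (t - s) ^ (y - 1)) := by
    have := Real.rpow_nonneg hs.1.le (x - 1)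
    have := Real.rpow_nonneg (sub_nonneg.2 hs.2.le) (y - 1)
    positivity
  refine (mul_le_mul_of_nonneg_left h3 h4).trans_eq (by ring)

theorem ae_mem_Ioc_imp_mem_Ioo (a b : ℝ) : ∀ᵐ s : ℝ, s ∈ Set.Ioc a b → s ∈ Set.Ioo a b := by
  filter_upwards [Measure.ae_ne volume b] with s hs h1
  exact ⟨h1.1, lt_of_le_of_ne h1.2 hs⟩

theorem intervalIntegrable_gridConv (hh : 0 < h) (hC₁ : 0 < C₁) (hC : 0 ≤ C) (hD : 0 ≤ D)
    (hx : 0 < x) (hy : 0 < y) (hK : LorentzBounded h T C₁ C y K)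
    (hP : LorentzBounded h T C₁ D x P) {t : ℝ} (ht : t ∈ Set.Ioc 0 T) (α β : Fin d → ℤ) :
    IntervalIntegrable (fun s => gridConv h (K (t - s)) (P s) α β) volume 0 t := by
  rw [intervalIntegrable_iff_integrableOn_Ioc_of_le ht.1.le]
  have hI := (intervalIntegrable_rpow_mul_sub_rpow hx hy ht.1).const_mul
    (C * D * 80 ^ d * lorentzProd h (C₁ * t) (α - β))
  rw [intervalIntegrable_iff_integrableOn_Ioc_of_le ht.1.le] at hI
  refine Integrable.mono' hI ?_ ?_
  · refine (aemeasurable_truncConv hK hP α β t).restrict.aestronglyMeasurable.congr ?_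
    rw [EventuallyEq, ae_restrict_iff' measurableSet_Ioc]
    filter_upwards [ae_mem_Ioc_imp_mem_Ioo 0 t] with s hs hs'
    exact truncConv_eq_gridConv ht.2 (hs hs') α β
  · rw [ae_restrict_iff' measurableSet_Ioc]
    filter_upwards [ae_mem_Ioc_imp_mem_Ioo 0 t] with s hs hs'
    exact norm_gridConv_le hh hC₁ hC hD hK hP ht.2 (hs hs') α β

/-- Integrating the spatial bound in s leaves the Beta integral; the exponents x and y add. -/
theorem LorentzBounded.spaceTimeConv (hh : 0 < h) (hC₁ : 0 < C₁) (hC : 0 ≤ C) (hD : 0 ≤ D)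
    (hx : 0 < x) (hy : 0 < y) (hK : LorentzBounded h T C₁ C y K)
    (hP : LorentzBounded h T C₁ D x P) :
    LorentzBounded h T C₁
      (C * D * 80 ^ d * (Real.Gamma x * Real.Gamma y / Real.Gamma (x + y))) (x + y)
      (spaceTimeConv h K P) where
  aemeasurable α β := by
    have := (aemeasurable_truncConv_prod hK hP α β).aestronglyMeasurable.integral_prod_right'
    refine this.aemeasurable.restrict.congr ?_
    rw [EventuallyEq, ae_restrict_iff' measurableSet_Ioc]
    exact Eventually.of_forall fun t ht => (spaceTimeConv_eq_integral_truncConv ht α β).symm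
  bound t ht α β := by
    have hI := (intervalIntegrable_rpow_mul_sub_rpow hx hy ht.1).const_mul
      (C * D * 80 ^ d * lorentzProd h (C₁ * t) (α - β))
    have := intervalIntegral.norm_integral_le_of_norm_le (μ := volume) ht.1.le
      (f := fun s => gridConv h (K (t - s)) (P s) α β) (by
        filter_upwards [ae_mem_Ioc_imp_mem_Ioo 0 t] with s hs hs'
        exact norm_gridConv_le hh hC₁ hC hD hK hP ht.2 (hs hs') α β) hI
    rw [intervalIntegral.integral_const_mul, integral_rpow_mul_sub_rpow hx hy ht.1] at this
    refine this.trans_eq (by ring)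

end conv

/-! ### Induction on the iterated kernels. -/

section iterate
variable {d : ℕ} {h T C₁ C : ℝ} {K : ℝ → (Fin d → ℤ) → (Fin d → ℤ) → ℝ}

/-- The geometric rate in the bounds for the iterated kernels. -/
def iterRate (d : ℕ) (C : ℝ) : ℝ := √Real.pi * max 1 (C * 80 ^ d)

theorem iterRate_pos (d : ℕ) (C : ℝ) : 0 < iterRate d C := by
  have := Real.pi_pos
  unfold iterRate
  positivity

theorem LorentzBounded.mono {D D' x : ℝ} {P : ℝ → (Fin d → ℤ) → (Fin d → ℤ) → ℝ} (hh : 0 < h)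
    (hC₁ : 0 < C₁) (hP : LorentzBounded h T C₁ D x P) (hD : D ≤ D') :
    LorentzBounded h T C₁ D' x P where
  aemeasurable := hP.aemeasurable
  bound t ht α β := by
    refine (hP.bound t ht α β).trans ?_
    have h1 := Real.rpow_nonneg ht.1.le (x - 1)
    have h2 := (lorentzProd_pos hh (mul_pos hC₁ ht.1) (α - β)).le
    gcongr

/-- The coefficient in the bound for the `m`-th iterated kernel. -/
def iterCoeff (d : ℕ) (C : ℝ) (m : ℕ) : ℝ := C * iterRate d C ^ m / Real.Gamma ((m : ℝ) / 2)

theorem iterCoeff_nonneg (hC : 0 ≤ C) (m : ℕ) : 0 ≤ iterCoeff d C m := by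
  have := iterRate_pos d C
  have : 0 ≤ Real.Gamma ((m : ℝ) / 2) := Real.Gamma_nonneg_of_nonneg (by positivity)
  unfold iterCoeff
  positivity

/-- Every convolution with K adds 1/2 to the exponent. The factor Γ((m+1)/2) of the Beta value
cancels the denominator of the previous step, and Γ(1/2) = √π together with C·80^d is absorbed by
`iterRate`. -/
theorem LorentzBounded.iterKernel (hh : 0 < h) (hC₁ : 0 < C₁) (hC : 0 ≤ C)
    (hK : LorentzBounded h T C₁ C (1 / 2) K) (m : ℕ) :
    LorentzBounded h T C₁ (iterCoeff d C (m + 1)) (((m + 1 : ℕ) : ℝ) / 2)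
      (iterKernel h K (m + 1)) := by
  have hπ : 0 < √Real.pi := Real.sqrt_pos.2 Real.pi_pos
  induction m with
  | zero =>
    norm_num only [zero_add, Nat.cast_one]
    refine hK.mono hh hC₁ ?_
    -- The maximum with 1 in `iterRate` serves this base case: the rate must be at least Γ(1/2) =
    -- √π.
    rw [iterCoeff, Nat.cast_one, Real.Gamma_one_half_eq, pow_one, le_div_iff₀ hπ, iterRate]
    have : √Real.pi * 1 ≤ √Real.pi * max 1 (C * 80 ^ d) := by gcongr; exact le_max_left _ _
    nlinarith
  | succ m ih =>
    have hx : (0 : ℝ) < ((m + 1 : ℕ) : ℝ) / 2 := by positivity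
    have key := hK.spaceTimeConv hh hC₁ hC (iterCoeff_nonneg hC _) hx (by norm_num) ih
    have hx' : ((m + 1 : ℕ) : ℝ) / 2 + 1 / 2 = ((m + 1 + 1 : ℕ) : ℝ) / 2 := by push_cast; ring
    rw [hx'] at key
    -- `iterKernel` at m + 2 unfolds definitionally to `spaceTimeConv`.
    refine LorentzBounded.mono hh hC₁ key ?_
    have hG := Real.Gamma_pos_of_pos hx
    have hG' : 0 < Real.Gamma (((m + 1 + 1 : ℕ) : ℝ) / 2) :=
      Real.Gamma_pos_of_pos (by positivity)
    have hr := iterRate_pos d C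
    rw [Real.Gamma_one_half_eq, iterCoeff, iterCoeff]
    calc _ = C * iterRate d C ^ (m + 1) * (√Real.pi * (C * 80 ^ d)) /
          Real.Gamma (((m + 1 + 1 : ℕ) : ℝ) / 2) := by field_simp
      _ ≤ C * iterRate d C ^ (m + 1) * iterRate d C /
          Real.Gamma (((m + 1 + 1 : ℕ) : ℝ) / 2) := by
        have : √Real.pi * (C * 80 ^ d) ≤ iterRate d C := by
          unfold iterRate; gcongr; exact le_max_right _ _
        gcongr
      _ = _ := by ring

theorem LorentzBounded.of_lorentzMajorant (hh : 0 < h) (hC₁ : 0 < C₁)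
    (hm : ∀ α β, AEMeasurable (fun t => K t α β) (volume.restrict (Set.Ioc 0 T)))
    (hb : ∀ t ∈ Set.Ioc 0 T, ∀ α β, |K t α β| ≤ C * lorentzMajorant C₁ h t (α - β)) :
    LorentzBounded h T C₁ C (1 / 2) K where
  aemeasurable := hm
  bound t ht α β := by
    refine (hb t ht α β).trans_eq ?_
    rw [lorentzMajorant_eq hC₁ hh ht.1, show (1 / 2 : ℝ) - 1 = -(1 / 2) by norm_num, mul_assoc]

theorem rpow_mul_lorentzMajorant (hh : 0 < h) (hC₁ : 0 < C₁) {t : ℝ} (ht : 0 < t) (m : ℝ)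
    (α : Fin d → ℤ) : t ^ ((m - 1) / 2) * lorentzMajorant C₁ h t α =
      t ^ (m / 2 - 1) * lorentzProd h (C₁ * t) α := by
  rw [lorentzMajorant_eq hC₁ hh ht, ← mul_assoc, ← Real.rpow_add ht]
  congr 2; ring

theorem abs_iterKernel_le (hh : 0 < h) (hC₁ : 0 < C₁) (hC : 0 ≤ C)
    (hK : LorentzBounded h T C₁ C (1 / 2) K) {m : ℕ} (hm : 1 ≤ m) {t : ℝ} (ht : t ∈ Set.Ioc 0 T)
    (α β : Fin d → ℤ) :
    |iterKernel h K m t α β| ≤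
      C * iterRate d C ^ m / Real.Gamma ((m : ℝ) / 2) * t ^ (((m : ℝ) - 1) / 2) *
        lorentzMajorant C₁ h t (α - β) := by
  obtain ⟨m, rfl⟩ := Nat.exists_eq_add_of_le' hm
  rw [mul_assoc, rpow_mul_lorentzMajorant hh hC₁ ht.1, ← mul_assoc]
  exact (hK.iterKernel hh hC₁ hC m).bound t ht α β

theorem iterKernelWellDefined (hh : 0 < h) (hC₁ : 0 < C₁) (hC : 0 ≤ C)
    (hK : LorentzBounded h T C₁ C (1 / 2) K) : IterKernelWellDefined h T K := by
  intro m hm t ht α β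
  obtain ⟨m, rfl⟩ := Nat.exists_eq_add_of_le' hm
  have hP := hK.iterKernel hh hC₁ hC m
  exact ⟨fun s hs => summable_gridConv hh hC₁ hK hP ht.2 hs α β,
    intervalIntegrable_gridConv hh hC₁ hC (iterCoeff_nonneg hC _) (by positivity) (by norm_num)
      hK hP ht α β⟩

end iterate

/-! ### Summability against Gamma functions and normal convergence. -/

theorem summable_pow_div_Gamma_add {a y : ℝ} (ha : 0 < a) (hy : 0 < y) :
    Summable fun n : ℕ => y ^ n / Real.Gamma (n + a) := by
  have hG : ∀ n : ℕ, 0 < Real.Gamma (n + a) := fun n => Real.Gamma_pos_of_pos (by positivity)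
  refine summable_of_ratio_test_tendsto_lt_one (l := 0) one_pos
    (Eventually.of_forall fun n => (div_pos (pow_pos hy n) (hG n)).ne') ?_
  have h1 : Tendsto (fun n : ℕ => y / ((n : ℝ) + a)) atTop (𝓝 0) :=
    tendsto_const_nhds.div_atTop
      (tendsto_atTop_add_const_right _ _ tendsto_natCast_atTop_atTop)
  refine h1.congr fun n => ?_
  have hn : 0 < (n : ℝ) + a := by positivity
  have hrec : Real.Gamma (((n + 1 : ℕ) : ℝ) + a) = (n + a) * Real.Gamma (n + a) := by
    rw [← Real.Gamma_add_one hn.ne']; congr 1; push_cast; ring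
  rw [Real.norm_of_nonneg (div_pos (pow_pos hy _) (hG _)).le,
    Real.norm_of_nonneg (div_pos (pow_pos hy _) (hG _)).le, hrec]
  have := hG n
  have := pow_pos hy n
  rw [pow_succ]
  field_simp

/-- Splitting by parity of m reduces to Γ(n + 1/2) and Γ(n + 1), where the functional equation
permits the ratio test. -/
theorem summable_pow_div_Gamma_half {x : ℝ} (hx : 0 < x) :
    Summable fun m : ℕ => x ^ m / Real.Gamma (((m + 1 : ℕ) : ℝ) / 2) := by
  refine (HasSum.even_add_odd (Summable.hasSum ?_) (Summable.hasSum ?_)).summable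
  · refine (summable_pow_div_Gamma_add (a := 1 / 2) (by norm_num) (pow_pos hx 2)).congr fun n => ?_
    rw [pow_mul]; congr 2; push_cast; ring
  · refine ((summable_pow_div_Gamma_add (a := 1) one_pos (pow_pos hx 2)).mul_left x).congr
      fun n => ?_
    rw [pow_succ x (2 * n), pow_mul, mul_div_assoc', mul_comm x]; congr 2; push_cast; ring

theorem summable_iterCoeff (d : ℕ) (C : ℝ) {T : ℝ} (hT : 0 < T) :
    Summable fun m : ℕ => iterCoeff d C (m + 1) * T ^ ((m : ℝ) / 2) := by
  have hr := iterRate_pos d C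
  have hs : 0 < √T := Real.sqrt_pos.2 hT
  refine ((summable_pow_div_Gamma_half (mul_pos hr hs)).mul_left (C * iterRate d C)).congr
    fun m => ?_
  rw [rpow_half_natCast hT.le, iterCoeff, mul_pow]
  ring

/-- Normal convergence of a series of functions on `(0, T]` in the weighted sup norm with
integrable weight `g` gives pointwise and `L¹` convergence. -/
theorem series_converges_of_norm_bounded {u : ℕ → ℝ → ℝ} {b : ℕ → ℝ} {g : ℝ → ℝ} {T : ℝ}
    (hT : 0 < T) (hu : ∀ m, AEMeasurable (u m) (volume.restrict (Set.Ioc 0 T)))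
    (hb : Summable b) (hg : IntervalIntegrable g volume 0 T)
    (hbound : ∀ m, ∀ t ∈ Set.Ioc 0 T, |u m t| ≤ b m * g t) :
    (∀ m, IntervalIntegrable (u m) volume 0 T) ∧
    Summable (fun m => ∫ t in (0 : ℝ)..T, |u m t|) ∧
    (∀ t ∈ Set.Ioc 0 T, Summable fun m => |u m t|) ∧
    IntervalIntegrable (fun t => ∑' m, u m t) volume 0 T ∧
    Tendsto (fun M : ℕ => ∫ t in (0 : ℝ)..T, |∑' m, u m t - ∑ m ∈ Finset.range M, u m t|)
      atTop (𝓝 0) := by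
  have hpt : ∀ t ∈ Set.Ioc 0 T, Summable fun m => |u m t| := fun t ht =>
    Summable.of_nonneg_of_le (fun m => abs_nonneg _) (fun m => hbound m t ht) (hb.mul_right _)
  have hu' : ∀ m, AEStronglyMeasurable (u m) (volume.restrict (Set.uIoc 0 T)) := fun m => by
    rw [Set.uIoc_of_le hT.le]; exact (hu m).aestronglyMeasurable
  have hsum' : AEStronglyMeasurable (fun t => ∑' m, u m t) (volume.restrict (Set.uIoc 0 T)) := by
    rw [Set.uIoc_of_le hT.le]; exact (AEMeasurable.tsum hu).aestronglyMeasurable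
  have hint : ∀ m, IntervalIntegrable (u m) volume 0 T := fun m => by
    refine (hg.const_mul (b m)).mono_fun' (hu' m) ?_
    rw [EventuallyLE, ae_restrict_iff' measurableSet_uIoc]
    refine Eventually.of_forall fun t ht => ?_
    rw [Set.uIoc_of_le hT.le] at ht
    exact hbound m t ht
  -- One integrable dominating function for all M: the case M = 0 gives integrability of the sum,
  -- and all M together give dominated convergence.
  have htail : ∀ t ∈ Set.Ioc 0 T, ∀ M, |∑' m, u m t - ∑ m ∈ Finset.range M, u m t| ≤
      (∑' m, b m) * g t := by
    intro t ht M
    rw [← (hpt t ht).of_abs.sum_add_tsum_nat_add M, add_sub_cancel_left]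
    have h1 : Summable fun m => |u (m + M) t| := (summable_nat_add_iff (f := fun m => |u m t|) M).2 (hpt t ht)
    have h2 : |∑' m, u (m + M) t| ≤ ∑' m, |u (m + M) t| :=
      tsum_of_norm_bounded (f := fun m => u (m + M) t) h1.hasSum fun m => le_rfl
    have h3 : 0 ≤ ∑ m ∈ Finset.range M, |u m t| := Finset.sum_nonneg fun _ _ => abs_nonneg _
    have h4 := (hpt t ht).sum_add_tsum_nat_add M
    have h5 : ∑' m, |u m t| ≤ ∑' m, b m * g t :=
      (hpt t ht).tsum_le_tsum (fun m => hbound m t ht) (hb.mul_right _)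
    rw [tsum_mul_right] at h5
    linarith
  have hmem : ∀ t, t ∈ Set.uIoc 0 T → t ∈ Set.Ioc 0 T := fun t ht => by
    rwa [Set.uIoc_of_le hT.le] at ht
  refine ⟨hint, ?_, hpt, ?_, ?_⟩
  · refine Summable.of_nonneg_of_le (fun m => ?_) (fun m => ?_)
      (hb.mul_right (∫ t in (0 : ℝ)..T, g t))
    · exact intervalIntegral.integral_nonneg hT.le fun t _ => abs_nonneg _
    · rw [← intervalIntegral.integral_const_mul]
      refine intervalIntegral.integral_mono_on_of_le_Ioo hT.le (hint m).abs (hg.const_mul _) ?_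
      exact fun t ht => hbound m t ⟨ht.1, ht.2.le⟩
  · refine (hg.const_mul (∑' m, b m)).mono_fun' hsum' ?_
    rw [EventuallyLE, ae_restrict_iff' measurableSet_uIoc]
    exact Eventually.of_forall fun t ht => by simpa using htail t (hmem t ht) 0
  · have h0 : ∫ t in (0 : ℝ)..T, (fun _ : ℝ => (0 : ℝ)) t = 0 := by simp
    suffices h1 : Tendsto (fun M : ℕ => ∫ t in (0 : ℝ)..T,
        |∑' m, u m t - ∑ m ∈ Finset.range M, u m t|) atTop
        (𝓝 (∫ t in (0 : ℝ)..T, (fun _ : ℝ => (0 : ℝ)) t)) by rwa [h0] at h1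
    refine intervalIntegral.tendsto_integral_filter_of_dominated_convergence
      (F := fun M t => |∑' m, u m t - ∑ m ∈ Finset.range M, u m t|) (l := atTop)
      (fun t => (∑' m, b m) * g t) ?_ ?_ (hg.const_mul _) ?_
    · refine Eventually.of_forall fun M => ?_
      refine (hsum'.sub ?_).norm
      exact Finset.aestronglyMeasurable_fun_sum _ fun m _ => hu' m
    · refine Eventually.of_forall fun M => Eventually.of_forall fun t ht => ?_
      rw [Real.norm_eq_abs, abs_abs]
      exact htail t (hmem t ht) M
    · refine Eventually.of_forall fun t ht => ?_
      have h1 := (hpt t (hmem t ht)).of_abs.hasSum.tendsto_sum_nat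
      have h2 := (tendsto_const_nhds (x := ∑' m, u m t)).sub h1
      rw [sub_self] at h2
      simpa using h2.abs

/-! ### The Neumann series. -/

section neumann
variable {d : ℕ} {h T C₁ C : ℝ} {K : ℝ → (Fin d → ℤ) → (Fin d → ℤ) → ℝ}

/-- The constant in the bound for the Neumann series. -/
def neumannBound (d : ℕ) (C T : ℝ) : ℝ :=
  1 + ∑' m : ℕ, iterCoeff d C (m + 1) * T ^ ((m : ℝ) / 2)

theorem neumannBound_pos (hC : 0 ≤ C) (hT : 0 < T) : 0 < neumannBound d C T := by
  have : 0 ≤ ∑' m : ℕ, iterCoeff d C (m + 1) * T ^ ((m : ℝ) / 2) :=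
    tsum_nonneg fun m => mul_nonneg (iterCoeff_nonneg hC _) (by positivity)
  unfold neumannBound
  linarith

theorem abs_iterKernel_succ_le (hh : 0 < h) (hC₁ : 0 < C₁) (hC : 0 ≤ C)
    (hK : LorentzBounded h T C₁ C (1 / 2) K) (m : ℕ) {t : ℝ} (ht : t ∈ Set.Ioc 0 T)
    (α β : Fin d → ℤ) :
    |iterKernel h K (m + 1) t α β| ≤
      iterCoeff d C (m + 1) * T ^ ((m : ℝ) / 2) * lorentzMajorant C₁ h t (α - β) := by
  refine (abs_iterKernel_le hh hC₁ hC hK (Nat.le_add_left 1 m) ht α β).trans ?_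
  have h1 : 0 ≤ lorentzMajorant C₁ h t (α - β) := by
    rw [lorentzMajorant_eq hC₁ hh ht.1]
    exact mul_nonneg (Real.rpow_nonneg ht.1.le _) (lorentzProd_pos hh (mul_pos hC₁ ht.1) _).le
  have h2 := iterCoeff_nonneg (d := d) hC (m + 1)
  have h3 : t ^ ((((m + 1 : ℕ) : ℝ) - 1) / 2) ≤ T ^ ((m : ℝ) / 2) := by
    have : (((m + 1 : ℕ) : ℝ) - 1) / 2 = (m : ℝ) / 2 := by push_cast; ring
    rw [this]
    exact Real.rpow_le_rpow ht.1.le ht.2 (by positivity)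
  exact mul_le_mul_of_nonneg_right (mul_le_mul_of_nonneg_left h3 h2) h1

theorem abs_neumannSum_le (hh : 0 < h) (hC₁ : 0 < C₁) (hC : 0 ≤ C)
    (hK : LorentzBounded h T C₁ C (1 / 2) K) {t : ℝ} (ht : t ∈ Set.Ioc 0 T) (α β : Fin d → ℤ) :
    |neumannSum h K t α β| ≤ neumannBound d C T * lorentzMajorant C₁ h t (α - β) := by
  have hT : 0 < T := ht.1.trans_le ht.2
  have h1 := tsum_of_norm_bounded (f := fun m => iterKernel h K (m + 1) t α β) (((summable_iterCoeff d C hT).mul_right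
    (lorentzMajorant C₁ h t (α - β))).hasSum)
    (fun m => abs_iterKernel_succ_le hh hC₁ hC hK m ht α β)
  refine h1.trans ?_
  rw [tsum_mul_right]
  have h2 : 0 ≤ lorentzMajorant C₁ h t (α - β) := by
    rw [lorentzMajorant_eq hC₁ hh ht.1]
    exact mul_nonneg (Real.rpow_nonneg ht.1.le _) (lorentzProd_pos hh (mul_pos hC₁ ht.1) _).le
  refine mul_le_mul_of_nonneg_right ?_ h2
  unfold neumannBound
  linarith

theorem sum_Icc_one_eq_sum_range {M : Type*} [AddCommMonoid M] (f : ℕ → M) (n : ℕ) :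
    ∑ m ∈ Finset.Icc 1 n, f m = ∑ m ∈ Finset.range n, f (m + 1) := by
  induction n with
  | zero => simp
  | succ n ih => rw [Finset.sum_Icc_succ_top (by omega), Finset.sum_range_succ, ih]

theorem neumannSeriesConverges (hh : 0 < h) (hC₁ : 0 < C₁) (hC : 0 ≤ C) (hT : 0 < T)
    (hK : LorentzBounded h T C₁ C (1 / 2) K) : NeumannSeriesConverges h T K := by
  intro α β
  -- At fixed h the caps bound the spatial product by h^(-d), so this weight is integrable at 0. It
  -- degenerates as h → 0, which is harmless: only convergence is claimed here, not a uniform bound.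
  have hg : IntervalIntegrable (fun t : ℝ => t ^ (-(1 / 2) : ℝ) * (1 / h) ^ d) volume 0 T :=
    (intervalIntegral.intervalIntegrable_rpow' (by norm_num)).mul_const _
  obtain ⟨h1, h2, h3, h4, h5⟩ := series_converges_of_norm_bounded
    (u := fun m t => iterKernel h K (m + 1) t α β) hT
    (fun m => (hK.iterKernel hh hC₁ hC m).aemeasurable α β) (summable_iterCoeff d C hT) hg
    (fun m t ht => by
      refine (abs_iterKernel_succ_le hh hC₁ hC hK m ht α β).trans ?_
      rw [lorentzMajorant_eq hC₁ hh ht.1]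
      have := iterCoeff_nonneg (d := d) hC (m + 1)
      have := lorentzProd_le_inv_pow hh (mul_pos hC₁ ht.1) (α - β)
      have := Real.rpow_nonneg ht.1.le (-(1 / 2) : ℝ)
      gcongr)
  refine ⟨fun m hm => ?_, h2, h3, h4, ?_⟩
  · obtain ⟨m, rfl⟩ := Nat.exists_eq_add_of_le' hm
    exact h1 m
  · refine h5.congr fun M => ?_
    simp only [sum_Icc_one_eq_sum_range]
    rfl

end neumann

/-! ### Fourier representation on ℤ: moments and integration by parts. -/

section fourier
open Real

/-- The symbol of the semigroup of the discrete Laplacian on `ℤ`. -/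
def heatSymbol (s θ : ℝ) : ℝ := exp (-(s * (2 - 2 * cos θ)))

/-- The Fourier coefficient on `[-π, π]` of the function `m · heatSymbol s`. -/
def heatFourier (s : ℝ) (m : ℝ → ℝ) (k : ℤ) : ℂ :=
  (1 / (2 * π) : ℝ) * ∫ θ in (-π)..π, ((m θ * heatSymbol s θ : ℝ) : ℂ) *
    Complex.exp (Complex.I * k * θ)

/-- The normalized moment `(2π)⁻¹ ∫ |m| heatSymbol s` over `[-π, π]`. -/
def heatMoment (s : ℝ) (m : ℝ → ℝ) : ℝ :=
  1 / (2 * π) * ∫ θ in (-π)..π, |m θ| * heatSymbol s θ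

theorem heatSymbol_pos (s θ : ℝ) : 0 < heatSymbol s θ := exp_pos _

@[fun_prop]
theorem continuous_heatSymbol (s : ℝ) : Continuous (heatSymbol s) := by
  unfold heatSymbol; fun_prop

theorem hasDerivAt_heatSymbol (s θ : ℝ) :
    HasDerivAt (heatSymbol s) (-(2 * s * sin θ) * heatSymbol s θ) θ := by
  have h1 := (((hasDerivAt_cos θ).const_mul 2).const_sub 2).const_mul (-s)
  have h2 : heatSymbol s = fun y => exp (-s * (2 - 2 * cos y)) := by
    funext y; rw [heatSymbol, neg_mul]
  rw [h2]
  convert h1.exp using 1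
  ring

theorem heatSymbol_le_one {s : ℝ} (hs : 0 ≤ s) (θ : ℝ) : heatSymbol s θ ≤ 1 := by
  unfold heatSymbol
  rw [exp_le_one_iff]
  nlinarith [cos_le_one θ]

theorem norm_exp_I_mul_intCast_mul (k : ℤ) (θ : ℝ) :
    ‖Complex.exp (Complex.I * k * θ)‖ = 1 := by
  rw [Complex.norm_exp]
  simp

theorem continuous_heatFourier_integrand (s : ℝ) {m : ℝ → ℝ} (hm : Continuous m) (k : ℤ) :
    Continuous fun θ : ℝ => ((m θ * heatSymbol s θ : ℝ) : ℂ) *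
      Complex.exp (Complex.I * k * θ) := by
  fun_prop

theorem norm_heatFourier_le (s : ℝ) (m : ℝ → ℝ) (hm : Continuous m) (k : ℤ) :
    ‖heatFourier s m k‖ ≤ heatMoment s m := by
  have hpi := pi_pos
  unfold heatFourier heatMoment
  rw [norm_mul, Complex.norm_real, Real.norm_of_nonneg (by positivity)]
  gcongr
  refine intervalIntegral.norm_integral_le_of_norm_le (by linarith) ?_
    (Continuous.intervalIntegrable (by fun_prop) _ _)
  refine Eventually.of_forall fun θ _ => ?_
  rw [norm_mul, norm_exp_I_mul_intCast_mul, Complex.norm_real, mul_one, norm_mul,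
    Real.norm_eq_abs, Real.norm_of_nonneg (heatSymbol_pos s θ).le]

theorem heatMoment_mono {s : ℝ} {m m' : ℝ → ℝ} (hm : Continuous m) (hm' : Continuous m')
    (h : ∀ θ ∈ Set.Icc (-π) π, |m θ| ≤ m' θ) : heatMoment s m ≤ heatMoment s m' := by
  have hpi := pi_pos
  unfold heatMoment
  gcongr
  refine intervalIntegral.integral_mono_on (by linarith)
    (Continuous.intervalIntegrable (by fun_prop) _ _)
    (Continuous.intervalIntegrable (by fun_prop) _ _) fun θ hθ => ?_
  exact mul_le_mul_of_nonneg_right ((h θ hθ).trans (le_abs_self _)) (heatSymbol_pos s θ).le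

theorem heatMoment_add_le {s : ℝ} {m m' : ℝ → ℝ} (hm : Continuous m) (hm' : Continuous m') :
    heatMoment s (fun θ => m θ + m' θ) ≤ heatMoment s m + heatMoment s m' := by
  have hpi := pi_pos
  unfold heatMoment
  rw [← mul_add, ← intervalIntegral.integral_add
    (Continuous.intervalIntegrable (by fun_prop) _ _)
    (Continuous.intervalIntegrable (by fun_prop) _ _)]
  gcongr
  refine intervalIntegral.integral_mono_on (by linarith)
    (Continuous.intervalIntegrable (by fun_prop) _ _)
    (Continuous.intervalIntegrable (by fun_prop) _ _) fun θ _ => ?_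
  have := heatSymbol_pos s θ
  rw [← add_mul]
  gcongr
  exact abs_add_le _ _

theorem heatMoment_const_mul (s c : ℝ) (m : ℝ → ℝ) :
    heatMoment s (fun θ => c * m θ) = |c| * heatMoment s m := by
  unfold heatMoment
  simp_rw [abs_mul, mul_assoc, intervalIntegral.integral_const_mul]
  ring

theorem heatMoment_const_mul_pow {c : ℝ} (hc : 0 ≤ c) (s : ℝ) (n : ℕ) :
    heatMoment s (fun θ => c * |θ| ^ n) = c * heatMoment s (fun θ => |θ| ^ n) := by
  rw [heatMoment_const_mul, abs_of_nonneg hc]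

theorem heatMoment_pow_le_pi_pow {s : ℝ} (hs : 0 ≤ s) (n : ℕ) :
    heatMoment s (fun θ => |θ| ^ n) ≤ π ^ n := by
  have hpi := pi_pos
  unfold heatMoment
  have h1 : ∫ θ in (-π)..π, |(|θ| ^ n)| * heatSymbol s θ ≤ ∫ _θ in (-π)..π, π ^ n := by
    refine intervalIntegral.integral_mono_on (by linarith)
      (Continuous.intervalIntegrable (by fun_prop) _ _) (by simp) fun θ hθ => ?_
    rw [abs_pow, abs_abs]
    calc |θ| ^ n * heatSymbol s θ ≤ π ^ n * 1 := by
          have := (heatSymbol_pos s θ).le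
          gcongr
          · exact abs_le.2 hθ
          · exact heatSymbol_le_one hs θ
      _ = π ^ n := mul_one _
  calc _ ≤ 1 / (2 * π) * ∫ _θ in (-π)..π, π ^ n := by gcongr
    _ = π ^ n := by
      rw [intervalIntegral.integral_const, smul_eq_mul]; field_simp; ring

theorem heatSymbol_le_gaussian {s θ : ℝ} (hs : 0 ≤ s) (hθ : θ ∈ Set.Icc (-π) π) :
    heatSymbol s θ ≤ exp (-(s * θ ^ 2 / 4)) := by
  unfold heatSymbol
  -- Since π² ≤ 16, this gives 2 - 2cos θ ≥ 4θ²/π² ≥ θ²/4 on [-π, π].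
  have h1 := cos_le_one_sub_mul_cos_sq (abs_le.2 hθ)
  have h2 : (1 : ℝ) / 8 ≤ 2 / π ^ 2 := by
    rw [div_le_div_iff₀ (by norm_num) (by positivity)]
    nlinarith [pi_lt_d2, pi_pos]
  have h3 : 1 / 8 * θ ^ 2 ≤ 2 / π ^ 2 * θ ^ 2 := by gcongr
  rw [exp_le_exp]
  nlinarith [mul_le_mul_of_nonneg_left h3 hs, mul_le_mul_of_nonneg_left h1 hs]

/-- Half of the Gaussian absorbs the power: x^n ≤ n!·e^x and x ≤ 1 + x²/2. -/
theorem pow_mul_exp_neg_sq_le (n : ℕ) {x : ℝ} (hx : 0 ≤ x) :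
    x ^ n * exp (-x ^ 2) ≤ n.factorial * exp 1 * exp (-x ^ 2 / 2) := by
  have h1 : x ^ n ≤ n.factorial * exp x := by
    have := pow_div_factorial_le_exp x hx n
    rwa [div_le_iff₀' (by positivity)] at this
  calc x ^ n * exp (-x ^ 2) ≤ n.factorial * exp x * exp (-x ^ 2) := by gcongr
    _ ≤ n.factorial * (exp 1 * exp (-x ^ 2 / 2)) := by
      rw [mul_assoc, ← exp_add, ← exp_add]
      refine mul_le_mul_of_nonneg_left (exp_le_exp.2 ?_) (by positivity)
      nlinarith [sq_nonneg (x - 1)]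
    _ = _ := by ring

theorem exists_heatMoment_pow_le (n : ℕ) :
    ∃ A : ℝ, ∀ s : ℝ, 0 < s → heatMoment s (fun θ => |θ| ^ n) ≤ A / √s ^ (n + 1) := by
  refine ⟨1 / (2 * π) * (2 ^ n * (n.factorial * exp 1) * √(8 * π)), fun s hs => ?_⟩
  have hpi := pi_pos
  have hr : 0 < √s := sqrt_pos.2 hs
  have hsq := sq_sqrt hs.le
  have hpt : ∀ θ ∈ Set.Icc (-π) π, |(|θ| ^ n)| * heatSymbol s θ ≤
      2 ^ n * (n.factorial * exp 1) / √s ^ n * exp (-(s / 8) * θ ^ 2) := by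
    intro θ hθ
    -- This x is chosen so that x² is the Gaussian exponent sθ²/4; the remaining half is integrated
    -- over ℝ.
    have h1 := pow_mul_exp_neg_sq_le n (x := √s * |θ| / 2) (by positivity)
    have h2 : (√s * |θ| / 2) ^ 2 = s * θ ^ 2 / 4 := by
      rw [div_pow, mul_pow, hsq, sq_abs]; norm_num
    rw [h2] at h1
    rw [abs_pow, abs_abs]
    calc |θ| ^ n * heatSymbol s θ ≤ |θ| ^ n * exp (-(s * θ ^ 2 / 4)) := by
          gcongr; exact heatSymbol_le_gaussian hs.le hθ
      _ = 2 ^ n / √s ^ n * ((√s * |θ| / 2) ^ n * exp (-(s * θ ^ 2 / 4))) := by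
          rw [div_pow, mul_pow]; field_simp
      _ ≤ 2 ^ n / √s ^ n * (n.factorial * exp 1 * exp (-(s * θ ^ 2 / 4) / 2)) := by gcongr
      _ = _ := by
        rw [show -(s * θ ^ 2 / 4) / 2 = -(s / 8) * θ ^ 2 by ring]; ring
  have hgauss : ∫ θ in (-π)..π, exp (-(s / 8) * θ ^ 2) ≤ √(8 * π) / √s := by
    rw [intervalIntegral.integral_of_le (by linarith), ← sqrt_div (by positivity)]
    have h1 := integral_gaussian (s / 8)
    rw [show π / (s / 8) = 8 * π / s by field_simp] at h1
    rw [← h1]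
    exact setIntegral_le_integral (integrable_exp_neg_mul_sq (by positivity))
      (Eventually.of_forall fun θ => (exp_pos _).le)
  calc heatMoment s (fun θ => |θ| ^ n) ≤ 1 / (2 * π) *
        ∫ θ in (-π)..π, 2 ^ n * (n.factorial * exp 1) / √s ^ n * exp (-(s / 8) * θ ^ 2) := by
        unfold heatMoment
        gcongr
        exact intervalIntegral.integral_mono_on (by linarith)
          (Continuous.intervalIntegrable (by fun_prop) _ _)
          (Continuous.intervalIntegrable (by fun_prop) _ _) hpt
    _ ≤ 1 / (2 * π) * (2 ^ n * (n.factorial * exp 1) / √s ^ n * (√(8 * π) / √s)) := by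
        rw [intervalIntegral.integral_const_mul]
        gcongr
    _ = _ := by rw [pow_succ]; field_simp

theorem heatFourier_sub_add (s : ℝ) (k : ℤ) :
    heatFourier s (fun _ => 1) (k + 1) - 2 * heatFourier s (fun _ => 1) k +
      heatFourier s (fun _ => 1) (k - 1) = heatFourier s (fun θ => 2 * cos θ - 2) k := by
  unfold heatFourier
  have hi : ∀ l : ℤ, IntervalIntegrable (fun θ : ℝ => (((fun _ => 1) θ * heatSymbol s θ : ℝ) : ℂ) *
      Complex.exp (Complex.I * l * θ)) volume (-π) π := fun l =>
    (continuous_heatFourier_integrand s continuous_const l).intervalIntegrable _ _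
  have key := intervalIntegral.integral_add ((hi (k + 1)).sub ((hi k).const_mul 2)) (hi (k - 1))
  rw [intervalIntegral.integral_sub (hi _) ((hi _).const_mul _),
    intervalIntegral.integral_const_mul] at key
  rw [mul_left_comm, ← mul_sub, ← mul_add, ← key]
  congr 1
  refine intervalIntegral.integral_congr fun θ _ => ?_
  have e1 : Complex.exp (Complex.I * ((k + 1 : ℤ) : ℂ) * θ) =
      Complex.exp (Complex.I * k * θ) * Complex.exp (θ * Complex.I) := by
    rw [← Complex.exp_add]; congr 1; push_cast; ring
  have e2 : Complex.exp (Complex.I * ((k - 1 : ℤ) : ℂ) * θ) =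
      Complex.exp (Complex.I * k * θ) * Complex.exp (-θ * Complex.I) := by
    rw [← Complex.exp_add]; congr 1; push_cast; ring
  have e3 : (2 : ℂ) * Complex.cos θ = _ := Complex.two_cos θ
  simp only [e1, e2]
  push_cast
  linear_combination (-(heatSymbol s θ : ℂ) * Complex.exp (Complex.I * k * θ)) * e3

/-- Integration by parts: multiplication by the frequency acts on the Fourier side as a first
order differential operator. -/
theorem intCast_mul_heatFourier (s : ℝ) {m m' : ℝ → ℝ} (hm : ∀ θ, HasDerivAt m (m' θ) θ)
    (hm' : Continuous m') (hper : m (-π) = m π) (k : ℤ) :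
    (k : ℂ) * heatFourier s m k =
      Complex.I * heatFourier s (fun θ => m' θ - 2 * s * sin θ * m θ) k := by
  have hmc : Continuous m := continuous_iff_continuousAt.2 fun θ => (hm θ).continuousAt
  set E : ℝ → ℂ := fun θ => Complex.exp (Complex.I * k * θ) with hE
  have hEd : ∀ θ, HasDerivAt E (Complex.I * k * E θ) θ := fun θ => by
    have h1 : HasDerivAt (fun x : ℝ => Complex.I * k * (x : ℂ)) (Complex.I * k * 1) θ :=
      (Complex.ofRealCLM.hasDerivAt (x := θ)).const_mul _
    convert h1.cexp using 1
    simp [hE]; ring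
  have hEc : Continuous E := continuous_iff_continuousAt.2 fun θ => (hEd θ).continuousAt
  have hEper : E (-π) = E π := by
    change Complex.exp _ = Complex.exp _
    rw [Complex.exp_eq_exp_iff_exists_int]
    exact ⟨-k, by push_cast; ring⟩
  set G : ℝ → ℝ := fun θ => m θ * heatSymbol s θ with hG
  set G' : ℝ → ℝ := fun θ => (m' θ - 2 * s * sin θ * m θ) * heatSymbol s θ with hG'
  have hGd : ∀ θ, HasDerivAt G (G' θ) θ := fun θ => by
    refine ((hm θ).mul (hasDerivAt_heatSymbol s θ)).congr_deriv ?_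
    change _ = (m' θ - 2 * s * sin θ * m θ) * heatSymbol s θ
    ring
  have hGc : Continuous G' := by fun_prop
  have hGper : G (-π) = G π := by simp [hG, hper, heatSymbol]
  have hparts := intervalIntegral.integral_mul_deriv_eq_deriv_mul (a := -π) (b := π)
    (u := fun θ => ((G θ : ℝ) : ℂ)) (v := E) (u' := fun θ => ((G' θ : ℝ) : ℂ))
    (v' := fun θ => Complex.I * k * E θ)
    (fun θ _ => (hGd θ).ofReal_comp) (fun θ _ => hEd θ)
    (Continuous.intervalIntegrable (by fun_prop) _ _)
    (Continuous.intervalIntegrable (by fun_prop) _ _)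
  rw [hGper, hEper, sub_self, zero_sub] at hparts
  have h2 : ∫ θ in (-π)..π, ((G θ : ℝ) : ℂ) * (Complex.I * k * E θ) =
      Complex.I * k * ∫ θ in (-π)..π, ((G θ : ℝ) : ℂ) * E θ := by
    rw [← intervalIntegral.integral_const_mul]
    exact intervalIntegral.integral_congr fun θ _ => by ring
  rw [h2] at hparts
  change (k : ℂ) * (_ * ∫ θ in (-π)..π, ((G θ : ℝ) : ℂ) * E θ) =
    Complex.I * (_ * ∫ θ in (-π)..π, ((G' θ : ℝ) : ℂ) * E θ)
  linear_combination (-Complex.I * (1 / (2 * π) : ℝ)) * hparts +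
    ((k : ℂ) * (1 / (2 * π) : ℝ) * ∫ θ in (-π)..π, ((G θ : ℝ) : ℂ) * E θ) * Complex.I_mul_I

theorem abs_mul_norm_heatFourier (s : ℝ) {m m' : ℝ → ℝ} (hm : ∀ θ, HasDerivAt m (m' θ) θ)
    (hm' : Continuous m') (hper : m (-π) = m π) (k : ℤ) :
    |(k : ℝ)| * ‖heatFourier s m k‖ =
      ‖heatFourier s (fun θ => m' θ - 2 * s * sin θ * m θ) k‖ := by
  have := congrArg norm (intCast_mul_heatFourier s hm hm' hper k)
  rwa [norm_mul, norm_mul, Complex.norm_I, one_mul, Complex.norm_intCast] at this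

end fourier

/-! ### Weighted bounds for the heat kernel of ℤ and its Laplacian. -/

section lineBounds
open Real

/-- Integration by parts in solved form: the new multiplier m₂ may be stated already simplified, and
only a derivative identity has to be checked. -/
theorem abs_mul_norm_heatFourier_of_hasDerivAt {s : ℝ} {m m₂ : ℝ → ℝ}
    (hm : ∀ θ, HasDerivAt m (m₂ θ + 2 * s * sin θ * m θ) θ) (hm₂ : Continuous m₂)
    (hper : m (-π) = m π) (k : ℤ) :
    |(k : ℝ)| * ‖heatFourier s m k‖ = ‖heatFourier s m₂ k‖ := by
  have hmc : Continuous m := continuous_iff_continuousAt.2 fun θ => (hm θ).continuousAt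
  rw [abs_mul_norm_heatFourier s hm (by fun_prop) hper k]
  simp only [add_sub_cancel_right]

theorem norm_heatFourier_le_three {s c₁ c₂ c₃ : ℝ} {m : ℝ → ℝ} {n₁ n₂ n₃ : ℕ} (hc₁ : 0 ≤ c₁)
    (hc₂ : 0 ≤ c₂) (hc₃ : 0 ≤ c₃) (hm : Continuous m)
    (h : ∀ θ, |m θ| ≤ c₁ * |θ| ^ n₁ + c₂ * |θ| ^ n₂ + c₃ * |θ| ^ n₃) (k : ℤ) :
    ‖heatFourier s m k‖ ≤ c₁ * heatMoment s (fun θ => |θ| ^ n₁) +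
      c₂ * heatMoment s (fun θ => |θ| ^ n₂) + c₃ * heatMoment s (fun θ => |θ| ^ n₃) := by
  refine (norm_heatFourier_le s m hm k).trans ?_
  refine (heatMoment_mono hm (by fun_prop) fun θ _ => h θ).trans ?_
  refine (heatMoment_add_le (by fun_prop) (by fun_prop)).trans ?_
  rw [← heatMoment_const_mul_pow hc₁, ← heatMoment_const_mul_pow hc₂,
    ← heatMoment_const_mul_pow hc₃]
  gcongr
  exact heatMoment_add_le (by fun_prop) (by fun_prop)

theorem two_sub_two_mul_cos_nonneg (θ : ℝ) : 0 ≤ 2 - 2 * cos θ := by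
  linarith [cos_le_one θ]

theorem two_sub_two_mul_cos_le_four (θ : ℝ) : 2 - 2 * cos θ ≤ 4 := by
  linarith [neg_one_le_cos θ]

theorem two_sub_two_mul_cos_le_sq (θ : ℝ) : 2 - 2 * cos θ ≤ |θ| ^ 2 := by
  rw [sq_abs]
  linarith [one_sub_sq_div_two_le_cos (x := θ)]

variable {s : ℝ}

theorem norm_heatFourier_one_le (k : ℤ) :
    ‖heatFourier s (fun _ => 1) k‖ ≤ heatMoment s (fun θ => |θ| ^ 0) := by
  have := norm_heatFourier_le_three (s := s) (c₁ := 1) (c₂ := 0) (c₃ := 0) (m := fun _ => 1)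
    (n₁ := 0) (n₂ := 0) (n₃ := 0) (by simp) le_rfl le_rfl continuous_const (by simp) k
  linarith

theorem abs_mul_norm_heatFourier_one (k : ℤ) :
    |(k : ℝ)| * ‖heatFourier s (fun _ => 1) k‖ = ‖heatFourier s (fun θ => -(2 * s * sin θ)) k‖ :=
  abs_mul_norm_heatFourier_of_hasDerivAt
    (fun θ => (hasDerivAt_const θ (1 : ℝ)).congr_deriv (by ring)) (by fun_prop) rfl k

theorem sq_mul_norm_heatFourier_one (k : ℤ) :
    |(k : ℝ)| ^ 2 * ‖heatFourier s (fun _ => 1) k‖ =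
      ‖heatFourier s (fun θ => -(2 * s * cos θ) + 4 * s ^ 2 * sin θ ^ 2) k‖ := by
  rw [pow_succ, pow_one, mul_assoc, abs_mul_norm_heatFourier_one]
  refine abs_mul_norm_heatFourier_of_hasDerivAt (fun θ => ?_) (by fun_prop) (by simp) k
  refine ((hasDerivAt_sin θ).const_mul (2 * s)).neg.congr_deriv ?_
  ring

/-- Third powers are needed since the bound weighted by |k| is compared with a cell whose
denominator is s + k². -/
theorem cube_mul_norm_heatFourier_one (k : ℤ) :
    |(k : ℝ)| ^ 3 * ‖heatFourier s (fun _ => 1) k‖ =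
      ‖heatFourier s (fun θ => 2 * s * sin θ + 12 * s ^ 2 * (sin θ * cos θ) -
        8 * s ^ 3 * sin θ ^ 3) k‖ := by
  rw [pow_succ', mul_assoc, sq_mul_norm_heatFourier_one]
  refine abs_mul_norm_heatFourier_of_hasDerivAt (fun θ => ?_) (by fun_prop) (by simp) k
  refine (((hasDerivAt_cos θ).const_mul (2 * s)).neg.add
    (((hasDerivAt_sin θ).pow 2).const_mul (4 * s ^ 2))).congr_deriv ?_
  push_cast
  ring

theorem abs_mul_norm_heatFourier_lap (k : ℤ) :
    |(k : ℝ)| * ‖heatFourier s (fun θ => 2 * cos θ - 2) k‖ =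
      ‖heatFourier s (fun θ => -(2 * sin θ) + 2 * s * (sin θ * (2 - 2 * cos θ))) k‖ := by
  refine abs_mul_norm_heatFourier_of_hasDerivAt (fun θ => ?_) (by fun_prop) (by simp) k
  refine (((hasDerivAt_cos θ).const_mul 2).sub_const 2).congr_deriv ?_
  ring

theorem sq_mul_norm_heatFourier_lap (k : ℤ) :
    |(k : ℝ)| ^ 2 * ‖heatFourier s (fun θ => 2 * cos θ - 2) k‖ =
      ‖heatFourier s (fun θ => -(2 * cos θ) + 2 * s * (cos θ * (2 - 2 * cos θ)) +
        8 * s * sin θ ^ 2 - 4 * s ^ 2 * (sin θ ^ 2 * (2 - 2 * cos θ))) k‖ := by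
  rw [pow_succ, pow_one, mul_assoc, abs_mul_norm_heatFourier_lap]
  refine abs_mul_norm_heatFourier_of_hasDerivAt (fun θ => ?_) (by fun_prop) (by simp) k
  refine (((hasDerivAt_sin θ).const_mul 2).neg.add (((hasDerivAt_sin θ).mul
    (((hasDerivAt_cos θ).const_mul 2).const_sub 2)).const_mul (2 * s))).congr_deriv ?_
  ring

theorem cube_mul_norm_heatFourier_lap (k : ℤ) :
    |(k : ℝ)| ^ 3 * ‖heatFourier s (fun θ => 2 * cos θ - 2) k‖ =
      ‖heatFourier s (fun θ => 2 * sin θ - 2 * s * (sin θ * (2 - 2 * cos θ)) +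
        24 * s * (sin θ * cos θ) - 12 * s ^ 2 * (sin θ * cos θ * (2 - 2 * cos θ)) -
        24 * s ^ 2 * sin θ ^ 3 + 8 * s ^ 3 * (sin θ ^ 3 * (2 - 2 * cos θ))) k‖ := by
  rw [pow_succ', mul_assoc, sq_mul_norm_heatFourier_lap]
  refine abs_mul_norm_heatFourier_of_hasDerivAt (fun θ => ?_) (by fun_prop) (by simp) k
  have hu := ((hasDerivAt_cos θ).const_mul 2).const_sub 2
  refine (((((hasDerivAt_cos θ).const_mul 2).neg.add
    (((hasDerivAt_cos θ).mul hu).const_mul (2 * s))).add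
    (((hasDerivAt_sin θ).pow 2).const_mul (8 * s))).sub
    ((((hasDerivAt_sin θ).pow 2).mul hu).const_mul (4 * s ^ 2))).congr_deriv ?_
  simp only [Pi.pow_apply]
  push_cast
  ring

theorem abs_mul_norm_heatFourier_one_le (hs : 0 < s) (k : ℤ) :
    |(k : ℝ)| * ‖heatFourier s (fun _ => 1) k‖ ≤ 2 * s * heatMoment s (fun θ => |θ| ^ 1) := by
  rw [abs_mul_norm_heatFourier_one]
  have := norm_heatFourier_le_three (s := s) (c₁ := 2 * s) (c₂ := 0) (c₃ := 0)
    (m := fun θ => -(2 * s * sin θ)) (n₁ := 1) (n₂ := 0) (n₃ := 0) (by positivity) le_rfl le_rfl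
    (by fun_prop) (fun θ => by
      have := Real.abs_sin_le_abs (x := θ)
      rw [abs_neg, abs_mul, abs_of_pos (by positivity)]
      nlinarith) k
  linarith

theorem sq_mul_norm_heatFourier_one_le (hs : 0 < s) (k : ℤ) :
    |(k : ℝ)| ^ 2 * ‖heatFourier s (fun _ => 1) k‖ ≤ 2 * s * heatMoment s (fun θ => |θ| ^ 0) +
      4 * s ^ 2 * heatMoment s (fun θ => |θ| ^ 2) := by
  rw [sq_mul_norm_heatFourier_one]
  have := norm_heatFourier_le_three (s := s) (c₁ := 2 * s) (c₂ := 4 * s ^ 2) (c₃ := 0)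
    (m := fun θ => -(2 * s * cos θ) + 4 * s ^ 2 * sin θ ^ 2)
    (n₁ := 0) (n₂ := 2) (n₃ := 0) (by positivity) (by positivity) le_rfl
    (by fun_prop) (fun θ => by
      have h1 : |2 * s * cos θ| ≤ 2 * s * 1 := by
        rw [abs_mul, abs_of_pos (by positivity)]; gcongr; exact abs_cos_le_one θ
      have h2 : |4 * s ^ 2 * sin θ ^ 2| ≤ 4 * s ^ 2 * |θ| ^ 2 := by
        rw [abs_mul, abs_pow (sin θ), abs_of_pos (by positivity)]; have := Real.abs_sin_le_abs (x := θ); gcongr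
      rw [abs_le] at h1 h2 ⊢
      constructor <;> linarith) k
  linarith

theorem cube_mul_norm_heatFourier_one_le (hs : 0 < s) (k : ℤ) :
    |(k : ℝ)| ^ 3 * ‖heatFourier s (fun _ => 1) k‖ ≤
      (2 * s + 12 * s ^ 2) * heatMoment s (fun θ => |θ| ^ 1) +
      8 * s ^ 3 * heatMoment s (fun θ => |θ| ^ 3) := by
  rw [cube_mul_norm_heatFourier_one]
  have := norm_heatFourier_le_three (s := s) (c₁ := 2 * s + 12 * s ^ 2) (c₂ := 8 * s ^ 3) (c₃ := 0)
    (m := fun θ => 2 * s * sin θ + 12 * s ^ 2 * (sin θ * cos θ) - 8 * s ^ 3 * sin θ ^ 3)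
    (n₁ := 1) (n₂ := 3) (n₃ := 0) (by positivity) (by positivity) le_rfl
    (by fun_prop) (fun θ => by
      have hsin := Real.abs_sin_le_abs (x := θ)
      have hcos := abs_cos_le_one θ
      have h1 : |2 * s * sin θ| ≤ 2 * s * |θ| := by
        rw [abs_mul, abs_of_pos (by positivity)]; gcongr
      have h2 : |12 * s ^ 2 * (sin θ * cos θ)| ≤ 12 * s ^ 2 * (|θ| * 1) := by
        rw [abs_mul, abs_mul (sin θ), abs_of_pos (by positivity)]; gcongr
      have h3 : |8 * s ^ 3 * sin θ ^ 3| ≤ 8 * s ^ 3 * |θ| ^ 3 := by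
        rw [abs_mul, abs_pow (sin θ), abs_of_pos (by positivity)]; gcongr
      rw [abs_le] at h1 h2 h3 ⊢
      constructor <;> linarith) k
  linarith

theorem norm_heatFourier_lap_le (k : ℤ) :
    ‖heatFourier s (fun θ => 2 * cos θ - 2) k‖ ≤ heatMoment s (fun θ => |θ| ^ 2) := by
  have := norm_heatFourier_le_three (s := s) (c₁ := 1) (c₂ := 0) (c₃ := 0)
    (m := fun θ => 2 * cos θ - 2) (n₁ := 2) (n₂ := 0) (n₃ := 0) (by positivity) le_rfl le_rfl
    (by fun_prop) (fun θ => by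
      rw [abs_sub_comm, abs_of_nonneg (two_sub_two_mul_cos_nonneg θ)]
      linarith [two_sub_two_mul_cos_le_sq θ]) k
  linarith

theorem abs_mul_norm_heatFourier_lap_le (hs : 0 < s) (k : ℤ) :
    |(k : ℝ)| * ‖heatFourier s (fun θ => 2 * cos θ - 2) k‖ ≤
      2 * heatMoment s (fun θ => |θ| ^ 1) + 2 * s * heatMoment s (fun θ => |θ| ^ 3) := by
  rw [abs_mul_norm_heatFourier_lap]
  have := norm_heatFourier_le_three (s := s) (c₁ := 2) (c₂ := 2 * s) (c₃ := 0)
    (m := fun θ => -(2 * sin θ) + 2 * s * (sin θ * (2 - 2 * cos θ)))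
    (n₁ := 1) (n₂ := 3) (n₃ := 0) (by positivity) (by positivity) le_rfl
    (by fun_prop) (fun θ => by
      have hsin := Real.abs_sin_le_abs (x := θ)
      have hu := two_sub_two_mul_cos_le_sq θ
      have hu0 := two_sub_two_mul_cos_nonneg θ
      have h1 : |2 * sin θ| ≤ 2 * |θ| := by
        rw [abs_mul, abs_of_pos (by positivity)]; gcongr
      have h2 : |2 * s * (sin θ * (2 - 2 * cos θ))| ≤ 2 * s * (|θ| * |θ| ^ 2) := by
        rw [abs_mul, abs_mul (sin θ), abs_of_pos (by positivity), abs_of_nonneg hu0]; gcongr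
      rw [abs_le] at h1 h2 ⊢
      constructor <;> nlinarith) k
  linarith

theorem sq_mul_norm_heatFourier_lap_le (hs : 0 < s) (k : ℤ) :
    |(k : ℝ)| ^ 2 * ‖heatFourier s (fun θ => 2 * cos θ - 2) k‖ ≤
      2 * heatMoment s (fun θ => |θ| ^ 0) + 10 * s * heatMoment s (fun θ => |θ| ^ 2) +
        4 * s ^ 2 * heatMoment s (fun θ => |θ| ^ 4) := by
  rw [sq_mul_norm_heatFourier_lap]
  refine norm_heatFourier_le_three (by positivity) (by positivity) (by positivity)
    (by fun_prop) (fun θ => ?_) k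
  have hsin := Real.abs_sin_le_abs (x := θ)
  have hcos := abs_cos_le_one θ
  have hu := two_sub_two_mul_cos_le_sq θ
  have hu0 := two_sub_two_mul_cos_nonneg θ
  have h1 : |2 * cos θ| ≤ 2 * 1 := by
    rw [abs_mul, abs_of_pos (by positivity)]; gcongr
  have h2 : |2 * s * (cos θ * (2 - 2 * cos θ))| ≤ 2 * s * (1 * |θ| ^ 2) := by
    rw [abs_mul, abs_mul (cos θ), abs_of_pos (by positivity), abs_of_nonneg hu0]; gcongr
  have h3 : |8 * s * sin θ ^ 2| ≤ 8 * s * |θ| ^ 2 := by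
    rw [abs_mul, abs_pow (sin θ), abs_of_pos (by positivity)]; gcongr
  have h4 : |4 * s ^ 2 * (sin θ ^ 2 * (2 - 2 * cos θ))| ≤ 4 * s ^ 2 * (|θ| ^ 2 * |θ| ^ 2) := by
    rw [abs_mul, abs_mul (sin θ ^ 2), abs_pow (sin θ), abs_of_pos (by positivity),
      abs_of_nonneg hu0]
    gcongr
  rw [show |θ| ^ 2 * |θ| ^ 2 = |θ| ^ 4 by ring] at h4
  rw [abs_le] at h1 h2 h3 h4 ⊢
  rw [pow_zero]
  constructor <;> linarith

theorem cube_mul_norm_heatFourier_lap_le (hs : 0 < s) (k : ℤ) :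
    |(k : ℝ)| ^ 3 * ‖heatFourier s (fun θ => 2 * cos θ - 2) k‖ ≤
      (2 + 32 * s) * heatMoment s (fun θ => |θ| ^ 1) +
        36 * s ^ 2 * heatMoment s (fun θ => |θ| ^ 3) +
        8 * s ^ 3 * heatMoment s (fun θ => |θ| ^ 5) := by
  rw [cube_mul_norm_heatFourier_lap]
  refine norm_heatFourier_le_three (by positivity) (by positivity) (by positivity)
    (by fun_prop) (fun θ => ?_) k
  have hsin := Real.abs_sin_le_abs (x := θ)
  have hcos := abs_cos_le_one θ
  have hu := two_sub_two_mul_cos_le_sq θ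
  have hu4 := two_sub_two_mul_cos_le_four θ
  have hu0 := two_sub_two_mul_cos_nonneg θ
  have h1 : |2 * sin θ| ≤ 2 * |θ| := by
    rw [abs_mul, abs_of_pos (by positivity)]; gcongr
  -- The bound 4 is used here instead of θ²: it places the term with s|θ|, whose moment stays
  -- bounded for all s.
  have h2 : |2 * s * (sin θ * (2 - 2 * cos θ))| ≤ 2 * s * (|θ| * 4) := by
    rw [abs_mul, abs_mul (sin θ), abs_of_pos (by positivity), abs_of_nonneg hu0]; gcongr
  have h3 : |24 * s * (sin θ * cos θ)| ≤ 24 * s * (|θ| * 1) := by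
    rw [abs_mul, abs_mul (sin θ), abs_of_pos (by positivity)]; gcongr
  have h4 : |12 * s ^ 2 * (sin θ * cos θ * (2 - 2 * cos θ))| ≤
      12 * s ^ 2 * (|θ| * 1 * |θ| ^ 2) := by
    rw [abs_mul, abs_mul (sin θ * cos θ), abs_mul (sin θ), abs_of_pos (by positivity),
      abs_of_nonneg hu0]
    gcongr
  have h5 : |24 * s ^ 2 * sin θ ^ 3| ≤ 24 * s ^ 2 * |θ| ^ 3 := by
    rw [abs_mul, abs_pow (sin θ), abs_of_pos (by positivity)]; gcongr
  have h6 : |8 * s ^ 3 * (sin θ ^ 3 * (2 - 2 * cos θ))| ≤ 8 * s ^ 3 * (|θ| ^ 3 * |θ| ^ 2) := by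
    rw [abs_mul, abs_mul (sin θ ^ 3), abs_pow (sin θ), abs_of_pos (by positivity),
      abs_of_nonneg hu0]
    gcongr
  rw [show |θ| ^ 3 * |θ| ^ 2 = |θ| ^ 5 by ring] at h6
  rw [show |θ| * 1 * |θ| ^ 2 = |θ| ^ 3 by ring] at h4
  rw [abs_le] at h1 h2 h3 h4 h5 h6 ⊢
  rw [pow_one]
  constructor <;> linarith

theorem exists_uniform_heatMoment_bound : ∃ A : ℝ, 1 ≤ A ∧ ∀ s : ℝ, 0 < s → ∀ n ≤ 5,
    √s ^ (n + 1) * heatMoment s (fun θ => |θ| ^ n) ≤ A := by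
  choose A hA using exists_heatMoment_pow_le
  refine ⟨1 + ∑ n ∈ Finset.range 6, |A n|, ?_, fun s hs n hn => ?_⟩
  · have : 0 ≤ ∑ n ∈ Finset.range 6, |A n| := Finset.sum_nonneg fun _ _ => abs_nonneg _
    linarith
  · have h1 := hA n s hs
    have hr : 0 < √s ^ (n + 1) := by positivity
    rw [le_div_iff₀ hr] at h1
    have h2 : |A n| ≤ ∑ n ∈ Finset.range 6, |A n| :=
      Finset.single_le_sum (f := fun n => |A n|) (fun _ _ => abs_nonneg _)
        (Finset.mem_range.2 (by omega))
    linarith [le_abs_self (A n)]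

/-- The `(0, ∞)`-uniform bounds for the heat kernel of `ℤ` and its discrete Laplacian by
Lorentzian cells. -/
theorem exists_heatFourier_bounds : ∃ A : ℝ, 0 < A ∧ ∀ s : ℝ, 0 < s → ∀ k : ℤ,
    ‖heatFourier s (fun _ => 1) k‖ ≤ A * lorentzCell 1 s k ∧
    |(k : ℝ)| * ‖heatFourier s (fun _ => 1) k‖ ≤ A * √s * lorentzCell 1 s k ∧
    ‖heatFourier s (fun θ => 2 * cos θ - 2) k‖ ≤ A / s * lorentzCell 1 s k ∧
    |(k : ℝ)| * ‖heatFourier s (fun θ => 2 * cos θ - 2) k‖ ≤ A / √s * lorentzCell 1 s k := by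
  obtain ⟨A, hA1, hA⟩ := exists_uniform_heatMoment_bound
  refine ⟨100 * A, by linarith, fun s hs k => ?_⟩
  have hr : 0 < √s := sqrt_pos.2 hs
  have hsq : s = √s ^ 2 := (sq_sqrt hs.le).symm
  have m0 : √s ^ 1 * heatMoment s (fun θ => |θ| ^ 0) ≤ A := hA s hs 0 (by norm_num)
  have m1 : √s ^ 2 * heatMoment s (fun θ => |θ| ^ 1) ≤ A := hA s hs 1 (by norm_num)
  have m2 : √s ^ 3 * heatMoment s (fun θ => |θ| ^ 2) ≤ A := hA s hs 2 (by norm_num)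
  have m3 : √s ^ 4 * heatMoment s (fun θ => |θ| ^ 3) ≤ A := hA s hs 3 (by norm_num)
  have m4 : √s ^ 5 * heatMoment s (fun θ => |θ| ^ 4) ≤ A := hA s hs 4 (by norm_num)
  have m5 : √s ^ 6 * heatMoment s (fun θ => |θ| ^ 5) ≤ A := hA s hs 5 (by norm_num)
  have p0 := (heatMoment_pow_le_pi_pow hs.le 0).trans_eq (pow_zero π)
  have p1 := heatMoment_pow_le_pi_pow hs.le 1
  have p2 := heatMoment_pow_le_pi_pow hs.le 2
  have f0 := norm_heatFourier_one_le (s := s) k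
  have f1 := abs_mul_norm_heatFourier_one_le hs k
  have f2 := sq_mul_norm_heatFourier_one_le hs k
  have f3 := cube_mul_norm_heatFourier_one_le hs k
  have g0 := norm_heatFourier_lap_le (s := s) k
  have g1 := abs_mul_norm_heatFourier_lap_le hs k
  have g2 := sq_mul_norm_heatFourier_lap_le hs k
  have g3 := cube_mul_norm_heatFourier_lap_le hs k
  have hXn := norm_nonneg (heatFourier s (fun _ => 1) k)
  have hYn := norm_nonneg (heatFourier s (fun θ => 2 * cos θ - 2) k)
  generalize ‖heatFourier s (fun _ => 1) k‖ = X at *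
  generalize ‖heatFourier s (fun θ => 2 * cos θ - 2) k‖ = Y at *
  generalize heatMoment s (fun θ => |θ| ^ 0) = M0 at *
  generalize heatMoment s (fun θ => |θ| ^ 1) = M1 at *
  generalize heatMoment s (fun θ => |θ| ^ 2) = M2 at *
  generalize heatMoment s (fun θ => |θ| ^ 3) = M3 at *
  generalize heatMoment s (fun θ => |θ| ^ 4) = M4 at *
  generalize heatMoment s (fun θ => |θ| ^ 5) = M5 at *
  have hpi := pi_lt_d2
  have hpi0 := pi_pos
  -- On the diagonal both entries of the minimum must be matched: decay in s from the weighted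
  -- moments, and the cap from the trivial bounds π^n.
  by_cases hk : k = 0
  · subst hk
    have hmin1 : 0 < min (1 / √s) (1 / 1) := by positivity
    have hX : X ≤ 100 * A * min (1 / √s) (1 / 1) := by
      rw [mul_min_of_nonneg _ _ (by positivity)]
      refine le_min ?_ ?_
      · rw [mul_one_div, le_div_iff₀ hr]
        nlinarith [mul_le_mul_of_nonneg_left f0 hr.le]
      · norm_num at p0 ⊢; linarith
    have hY : Y ≤ 100 * A / s * min (1 / √s) (1 / 1) := by
      rw [mul_min_of_nonneg _ _ (by positivity)]
      refine le_min ?_ ?_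
      · rw [mul_one_div, div_div, le_div_iff₀ (by positivity)]
        rw [show s * √s = √s ^ 3 by rw [pow_succ, ← hsq]]
        linarith [mul_le_mul_of_nonneg_left g0 (pow_nonneg hr.le 3)]
      · rw [div_one, mul_one, le_div_iff₀ hs, hsq]
        -- The weight s is controlled by s^(3/2) for large s, and by the trivial bound on the second
        -- moment for small s.
        rcases le_total 1 √s with h1 | h1
        · have h2 : √s ^ 2 ≤ √s ^ 3 := pow_le_pow_right₀ h1 (by norm_num)
          have h3 := mul_le_mul_of_nonneg_left h2 hYn
          linarith [mul_le_mul_of_nonneg_left g0 (pow_nonneg hr.le 3)]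
        · have h2 : √s ^ 2 ≤ 1 := pow_le_one₀ hr.le h1
          have h3 := mul_le_mul_of_nonneg_left h2 hYn
          nlinarith
    rw [lorentzCell_zero]
    refine ⟨hX, ?_, hY, ?_⟩
    · simp only [Int.cast_zero, abs_zero, zero_mul]; positivity
    · simp only [Int.cast_zero, abs_zero, zero_mul]; positivity
  · have hden : 0 < s + ((k : ℝ) * 1) ^ 2 := by positivity
    have hkk : ((k : ℝ) * 1) ^ 2 = |(k : ℝ)| ^ 2 := by rw [mul_one, sq_abs]
    rw [lorentzCell_of_ne hk, mul_div_assoc', mul_div_assoc', mul_div_assoc', mul_div_assoc',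
      le_div_iff₀ hden, le_div_iff₀ hden, le_div_iff₀ hden, le_div_iff₀ hden, hkk]
    generalize |(k : ℝ)| = N at *
    generalize √s = r at *
    subst hsq
    have e1 : 100 * A / r ^ 2 * r = 100 * A / r := by field_simp
    have e2 : 100 * A / r * r = 100 * A := by field_simp
    rw [e1, e2, le_div_iff₀ hr]
    have hr2 := pow_nonneg hr.le 2
    refine ⟨?_, ?_, ?_, ?_⟩
    · linarith [mul_le_mul_of_nonneg_left m0 hr.le, mul_le_mul_of_nonneg_left m2 hr.le,
        mul_le_mul_of_nonneg_left f0 hr2, mul_nonneg hr.le (by linarith : 0 ≤ A)]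
    -- The term 2s·M1 of the cubic bound must be O(s) as s → 0 too; this uses M1 ≤ π ≤ 4A, hence A ≥
    -- 1.
    · have h1 : r ^ 2 * M1 ≤ r ^ 2 * (4 * A) :=
        mul_le_mul_of_nonneg_left (by linarith) hr2
      linarith [mul_le_mul_of_nonneg_left m1 hr2, mul_le_mul_of_nonneg_left m3 hr2,
        mul_le_mul_of_nonneg_left f1 hr2, mul_nonneg hr2 (by linarith : 0 ≤ A)]
    · linarith [mul_le_mul_of_nonneg_left g0 (pow_nonneg hr.le 3),
        mul_le_mul_of_nonneg_left g2 hr.le]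
    · linarith [mul_le_mul_of_nonneg_left g1 hr2]

end lineBounds

/-! ### The heat kernel of ℤ and its rescaling to spacing h. -/

section lineKernel
open Real

/-- The heat kernel of the discrete Laplacian on `ℤ`. -/
def lineKernel (s : ℝ) (k : ℤ) : ℝ := (heatFourier s (fun _ => 1) k).re

/-- The discrete Laplacian of `lineKernel`. -/
def lineKernelLap (s : ℝ) (k : ℤ) : ℝ :=
  lineKernel s (k + 1) - 2 * lineKernel s k + lineKernel s (k - 1)

theorem lineKernelLap_eq_re (s : ℝ) (k : ℤ) :
    lineKernelLap s k = (heatFourier s (fun θ => 2 * cos θ - 2) k).re := by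
  rw [← heatFourier_sub_add]
  simp [lineKernelLap, lineKernel]

theorem abs_lineKernel_le (s : ℝ) (k : ℤ) :
    |lineKernel s k| ≤ ‖heatFourier s (fun _ => 1) k‖ := Complex.abs_re_le_norm _

theorem abs_lineKernelLap_le (s : ℝ) (k : ℤ) :
    |lineKernelLap s k| ≤ ‖heatFourier s (fun θ => 2 * cos θ - 2) k‖ := by
  rw [lineKernelLap_eq_re]; exact Complex.abs_re_le_norm _

theorem abs_lineKernel_le_one {s : ℝ} (hs : 0 ≤ s) (k : ℤ) : |lineKernel s k| ≤ 1 :=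
  (abs_lineKernel_le s k).trans ((norm_heatFourier_one_le k).trans
    ((heatMoment_pow_le_pi_pow hs 0).trans_eq (pow_zero π)))

theorem lineKernel_zero_time (k : ℤ) : lineKernel 0 k = if k = 0 then 1 else 0 := by
  split_ifs with hk
  · subst hk
    have : heatFourier 0 (fun _ => 1) 0 = 1 := by
      have hpi : (π : ℂ) ≠ 0 := by exact_mod_cast pi_ne_zero
      simp only [heatFourier, heatSymbol, zero_mul, neg_zero, exp_zero, mul_one, Complex.ofReal_one,
        Int.cast_zero, mul_zero, Complex.exp_zero, intervalIntegral.integral_const]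
      rw [sub_neg_eq_add, Complex.real_smul]
      push_cast
      field_simp
      ring
    simp [lineKernel, this]
  -- At s = 0 the integrated multiplier vanishes, so |k| times the coefficient is 0.
  · have h1 := abs_mul_norm_heatFourier_one (s := 0) k
    have h2 : heatFourier 0 (fun θ => -(2 * 0 * sin θ)) k = 0 := by simp [heatFourier]
    rw [h2, norm_zero, mul_eq_zero, abs_eq_zero, Int.cast_eq_zero] at h1
    have h3 := norm_eq_zero.1 (h1.resolve_left hk)
    simp [lineKernel, h3]

theorem hasDerivAt_heatFourier_one (s : ℝ) (k : ℤ) :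
    HasDerivAt (fun r => heatFourier r (fun _ => 1) k)
      (heatFourier s (fun θ => 2 * cos θ - 2) k) s := by
  unfold heatFourier
  refine HasDerivAt.const_mul _ ?_
  refine (intervalIntegral.hasDerivAt_integral_of_dominated_loc_of_deriv_le
    (F := fun r θ => ((1 * heatSymbol r θ : ℝ) : ℂ) * Complex.exp (Complex.I * k * θ))
    (F' := fun r θ => (((2 * cos θ - 2) * heatSymbol r θ : ℝ) : ℂ) *
      Complex.exp (Complex.I * k * θ))
    (bound := fun _ => 4 * exp ((|s| + 1) * 4)) (Metric.ball_mem_nhds s one_pos)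
    (Eventually.of_forall fun r => ?_) ?_ ?_ ?_ (by simp) ?_).2
  · exact (continuous_heatFourier_integrand r continuous_const k).aestronglyMeasurable
  · exact (continuous_heatFourier_integrand s continuous_const k).intervalIntegrable _ _
  · exact (continuous_heatFourier_integrand s (by fun_prop) k).aestronglyMeasurable
  · refine Eventually.of_forall fun θ _ r hr => ?_
    have hu0 := two_sub_two_mul_cos_nonneg θ
    have hu4 := two_sub_two_mul_cos_le_four θ
    rw [norm_mul, norm_exp_I_mul_intCast_mul, mul_one, Complex.norm_real, norm_mul,
      Real.norm_of_nonneg (heatSymbol_pos r θ).le, Real.norm_eq_abs, abs_sub_comm,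
      abs_of_nonneg hu0]
    refine mul_le_mul hu4 ?_ (heatSymbol_pos r θ).le (by norm_num)
    unfold heatSymbol
    rw [exp_le_exp, ← neg_mul]
    rw [Metric.mem_ball, Real.dist_eq] at hr
    have h1 : -r ≤ |s| + 1 := by
      have := abs_sub_abs_le_abs_sub r s
      have := neg_abs_le r
      linarith
    exact mul_le_mul h1 hu4 hu0 (by positivity)
  · refine Eventually.of_forall fun θ _ r _ => ?_
    refine HasDerivAt.mul_const ?_ _
    refine HasDerivAt.ofReal_comp ?_
    unfold heatSymbol
    have h1 : HasDerivAt (fun x : ℝ => -(x * (2 - 2 * cos θ))) (-(1 * (2 - 2 * cos θ))) r :=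
      ((hasDerivAt_id r).mul_const _).neg
    refine (h1.exp.const_mul 1).congr_deriv ?_
    ring

theorem hasDerivAt_lineKernel (s : ℝ) (k : ℤ) :
    HasDerivAt (fun r => lineKernel r k) (lineKernelLap s k) s := by
  rw [lineKernelLap_eq_re]
  exact Complex.reCLM.hasFDerivAt.comp_hasDerivAt s (hasDerivAt_heatFourier_one s k)

/-- The Lorentzian bounds for the heat kernel on the grid `h ℤ` and its discrete Laplacian. -/
theorem exists_lineKernel_bounds : ∃ A : ℝ, 0 < A ∧ ∀ h τ : ℝ, 0 < h → 0 < τ → ∀ k : ℤ,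
    |h⁻¹ * lineKernel (τ / h ^ 2) k| ≤ A * lorentzCell h τ k ∧
    |(k : ℝ) * h| * |h⁻¹ * lineKernel (τ / h ^ 2) k| ≤ A * √τ * lorentzCell h τ k ∧
    |h⁻¹ * lineKernelLap (τ / h ^ 2) k / h ^ 2| ≤ A / τ * lorentzCell h τ k ∧
    |(k : ℝ) * h| * |h⁻¹ * lineKernelLap (τ / h ^ 2) k / h ^ 2| ≤
      A / √τ * lorentzCell h τ k := by
  obtain ⟨A, hA0, hA⟩ := exists_heatFourier_bounds
  refine ⟨A, hA0, fun h τ hh hτ k => ?_⟩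
  obtain ⟨b1, b2, b3, b4⟩ := hA (τ / h ^ 2) (by positivity) k
  have hsq : √(τ / h ^ 2) = √τ / h := by rw [sqrt_div hτ.le, sqrt_sq hh.le]
  -- Diffusive scaling: cells scale like densities in space.
  have hcell : lorentzCell 1 (τ / h ^ 2) k = h * lorentzCell h τ k := by
    by_cases hk : k = 0
    · subst hk
      rw [lorentzCell_zero, lorentzCell_zero, hsq, mul_min_of_nonneg _ _ hh.le]
      congr 1 <;> field_simp
    · rw [lorentzCell_of_ne hk, lorentzCell_of_ne hk, hsq]
      field_simp
  rw [hcell] at b1 b2 b3 b4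
  rw [hsq] at b2 b4
  have c1 := abs_lineKernel_le (τ / h ^ 2) k
  have c2 := abs_lineKernelLap_le (τ / h ^ 2) k
  have hr : 0 < √τ := sqrt_pos.2 hτ
  have hN := abs_nonneg (k : ℝ)
  have d1 := mul_le_mul_of_nonneg_left c1 hN
  have d2 := mul_le_mul_of_nonneg_left c2 hN
  have hi : 0 < h⁻¹ := inv_pos.2 hh
  simp only [abs_mul, abs_div, abs_of_pos hi, abs_of_pos hh, abs_of_pos (pow_pos hh 2)]
  refine ⟨?_, ?_, ?_, ?_⟩
  · calc _ ≤ h⁻¹ * (A * (h * lorentzCell h τ k)) := by gcongr; exact c1.trans b1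
      _ = _ := by field_simp
  · calc _ = |(k : ℝ)| * |lineKernel (τ / h ^ 2) k| := by field_simp
      _ ≤ _ := d1.trans b2
      _ = _ := by field_simp
  · calc _ ≤ h⁻¹ * (A / (τ / h ^ 2) * (h * lorentzCell h τ k)) / h ^ 2 := by
          gcongr; exact c2.trans b3
      _ = _ := by field_simp
  · calc _ = |(k : ℝ)| * |lineKernelLap (τ / h ^ 2) k| / h ^ 2 := by field_simp
      _ ≤ (A / (√τ / h) * (h * lorentzCell h τ k)) / h ^ 2 :=
          div_le_div_of_nonneg_right (d2.trans b4) (by positivity)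
      _ = _ := by field_simp

end lineKernel

/-! ### Existence and uniqueness of the frozen heat kernel. -/

section gridKernel
variable {d : ℕ} {h : ℝ}

theorem gridForwardDiff_gridBackwardDiff (j : Fin d) (u : (Fin d → ℤ) → ℝ) (α : Fin d → ℤ) :
    gridForwardDiff h j (gridBackwardDiff h j u) α =
      (u (α + Pi.single j 1) - 2 * u α + u (α - Pi.single j 1)) / h ^ 2 := by
  unfold gridForwardDiff gridBackwardDiff
  rw [add_sub_cancel_right]
  ring

theorem prod_apply_add_single (g : Fin d → ℤ → ℝ) (α : Fin d → ℤ) (j : Fin d) (z : ℤ) :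
    ∏ i, g i ((α + Pi.single j z : Fin d → ℤ) i) =
      (∏ i ∈ Finset.univ.erase j, g i (α i)) * g j (α j + z) := by
  rw [← Finset.prod_erase_mul _ _ (Finset.mem_univ j)]
  congr 1
  · refine Finset.prod_congr rfl fun i hi => ?_
    simp [Pi.single_eq_of_ne (Finset.ne_of_mem_erase hi)]
  · simp

theorem gridForwardDiff_gridBackwardDiff_prod (g : Fin d → ℤ → ℝ) (j : Fin d) (α : Fin d → ℤ) :
    gridForwardDiff h j (gridBackwardDiff h j fun γ => ∏ i, g i (γ i)) α =
      (∏ i ∈ Finset.univ.erase j, g i (α i)) *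
        ((g j (α j + 1) - 2 * g j (α j) + g j (α j - 1)) / h ^ 2) := by
  rw [gridForwardDiff_gridBackwardDiff, prod_apply_add_single, sub_eq_add_neg α,
    ← Pi.single_neg, prod_apply_add_single, ← Finset.prod_erase_mul _ _ (Finset.mem_univ j),
    ← sub_eq_add_neg]
  ring

/-- The fundamental solution of the semi-discrete heat equation with constant coefficients. -/
def gridKernel (h : ℝ) (c : Fin d → ℝ) (t : ℝ) (α : Fin d → ℤ) : ℝ :=
  ∏ j, h⁻¹ * lineKernel (c j * t / h ^ 2) (α j)

theorem gridForwardDiff_gridBackwardDiff_gridKernel (c : Fin d → ℝ) (t : ℝ) (j : Fin d)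
    (α : Fin d → ℤ) :
    gridForwardDiff h j (gridBackwardDiff h j (gridKernel h c t)) α =
      (∏ i ∈ Finset.univ.erase j, h⁻¹ * lineKernel (c i * t / h ^ 2) (α i)) *
        (h⁻¹ * lineKernelLap (c j * t / h ^ 2) (α j) / h ^ 2) := by
  unfold gridKernel
  rw [gridForwardDiff_gridBackwardDiff_prod
    (fun i k => h⁻¹ * lineKernel (c i * t / h ^ 2) k), lineKernelLap]
  ring

theorem hasDerivAt_gridKernel (c : Fin d → ℝ) (t : ℝ) (α : Fin d → ℤ) :
    HasDerivAt (fun r => gridKernel h c r α)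
      (∑ j, c j * gridForwardDiff h j (gridBackwardDiff h j (gridKernel h c t)) α) t := by
  unfold gridKernel
  have h1 : ∀ j ∈ (Finset.univ : Finset (Fin d)),
      HasDerivAt (fun r => h⁻¹ * lineKernel (c j * r / h ^ 2) (α j))
        (h⁻¹ * (lineKernelLap (c j * t / h ^ 2) (α j) * (c j / h ^ 2))) t := fun j _ => by
    have h2 : HasDerivAt (fun r : ℝ => c j * r / h ^ 2) (c j / h ^ 2) t := by
      simpa using ((hasDerivAt_id t).const_mul (c j)).div_const (h ^ 2)
    exact ((hasDerivAt_lineKernel (c j * t / h ^ 2) (α j)).comp t h2).const_mul _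
  refine (HasDerivAt.fun_finsetProd h1).congr_deriv (Finset.sum_congr rfl fun j _ => ?_)
  have := gridForwardDiff_gridBackwardDiff_gridKernel (h := h) c t j α
  unfold gridKernel at this
  rw [this, smul_eq_mul]
  ring

theorem isSemiDiscreteHeatKernel_gridKernel (hh : 0 < h) {c : Fin d → ℝ} (hc : ∀ j, 0 ≤ c j) :
    IsSemiDiscreteHeatKernel h c (gridKernel h c) where
  initial α := by
    unfold gridKernel
    simp only [mul_zero, zero_div, lineKernel_zero_time]
    split_ifs with hα
    · simp [hα]
    · obtain ⟨j, hj⟩ := Function.ne_iff.1 hα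
      exact Finset.prod_eq_zero (Finset.mem_univ j) (by simp_all)
  continuousOn α t _ := (hasDerivAt_gridKernel c t α).continuousAt.continuousWithinAt
  hasDerivAt α t _ := hasDerivAt_gridKernel c t α
  bounded S _ := by
    refine ⟨(h⁻¹) ^ d, fun t ht α => ?_⟩
    unfold gridKernel
    rw [Finset.abs_prod]
    calc ∏ j, |h⁻¹ * lineKernel (c j * t / h ^ 2) (α j)| ≤ ∏ _j : Fin d, h⁻¹ := by
          refine Finset.prod_le_prod (fun _ _ => abs_nonneg _) fun j _ => ?_
          rw [abs_mul, abs_of_pos (inv_pos.2 hh)]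
          refine mul_le_of_le_one_right (inv_pos.2 hh).le (abs_lineKernel_le_one ?_ _)
          exact div_nonneg (mul_nonneg (hc j) ht.1) (by positivity)
      _ = _ := by simp

theorem abs_sum_gridForwardDiff_gridBackwardDiff_le {c : Fin d → ℝ} {u : (Fin d → ℤ) → ℝ} {b : ℝ}
    (hu : ∀ α, |u α| ≤ b) (α : Fin d → ℤ) :
    |∑ j, c j * gridForwardDiff h j (gridBackwardDiff h j u) α| ≤
      (∑ j, |c j| * (4 / h ^ 2)) * b := by
  rw [Finset.sum_mul]
  refine (Finset.abs_sum_le_sum_abs _ _).trans (Finset.sum_le_sum fun j _ => ?_)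
  rw [abs_mul, mul_assoc, gridForwardDiff_gridBackwardDiff, abs_div, abs_of_nonneg (sq_nonneg h),
    div_mul_eq_mul_div]
  gcongr
  have h1 := hu (α + Pi.single j 1)
  have h2 := hu α
  have h3 := hu (α - Pi.single j 1)
  rw [abs_le] at h1 h2 h3 ⊢
  constructor <;> linarith

/-- Both g - f and g + f are nondecreasing from 0; no derivative of f at 0 is required. -/
theorem abs_le_of_abs_deriv_le {f f' g g' : ℝ → ℝ} {S : ℝ} (hf : ContinuousOn f (Set.Icc 0 S))
    (hf' : ∀ t, 0 < t → HasDerivAt f (f' t) t) (hg' : ∀ t, HasDerivAt g (g' t) t)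
    (h0 : f 0 = 0) (g0 : g 0 = 0) (hle : ∀ t ∈ Set.Icc 0 S, |f' t| ≤ g' t) :
    ∀ t ∈ Set.Icc 0 S, |f t| ≤ g t := by
  intro t ht
  have hg : ContinuousOn g (Set.Icc 0 S) := fun t _ => (hg' t).continuousAt.continuousWithinAt
  have hpos : ∀ x ∈ interior (Set.Icc 0 S), 0 < x ∧ x ∈ Set.Icc 0 S := fun x hx => by
    rw [interior_Icc] at hx; exact ⟨hx.1, Set.Ioo_subset_Icc_self hx⟩
  have hS : (0 : ℝ) ∈ Set.Icc 0 S := ⟨le_rfl, ht.1.trans ht.2⟩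
  have m1 : MonotoneOn (g - f) (Set.Icc 0 S) := by
    refine monotoneOn_of_deriv_nonneg (convex_Icc _ _) (hg.sub hf) (fun x hx => ?_) fun x hx => ?_
    · exact ((hg' x).sub (hf' x (hpos x hx).1)).differentiableAt.differentiableWithinAt
    · rw [((hg' x).sub (hf' x (hpos x hx).1)).deriv]
      linarith [le_abs_self (f' x), hle x (hpos x hx).2]
  have m2 : MonotoneOn (g + f) (Set.Icc 0 S) := by
    refine monotoneOn_of_deriv_nonneg (convex_Icc _ _) (hg.add hf) (fun x hx => ?_) fun x hx => ?_
    · exact ((hg' x).add (hf' x (hpos x hx).1)).differentiableAt.differentiableWithinAt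
    · rw [((hg' x).add (hf' x (hpos x hx).1)).deriv]
      linarith [neg_abs_le (f' x), hle x (hpos x hx).2]
  have e1 := m1 hS ht ht.1
  have e2 := m2 hS ht ht.1
  simp only [Pi.sub_apply, Pi.add_apply, h0, g0, sub_zero, add_zero] at e1 e2
  rw [abs_le]
  constructor <;> linarith

/-- A bounded solution of the semi-discrete heat equation that starts from zero vanishes. -/
theorem eq_zero_of_semiDiscreteHeat {c : Fin d → ℝ} {w : ℝ → (Fin d → ℤ) → ℝ} {S M : ℝ}
    (h0 : ∀ α, w 0 α = 0) (hc : ∀ α, ContinuousOn (fun t => w t α) (Set.Ici 0))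
    (hd : ∀ α, ∀ t : ℝ, 0 < t → HasDerivAt (fun s => w s α)
      (∑ j, c j * gridForwardDiff h j (gridBackwardDiff h j (w t)) α) t)
    (hM : ∀ t ∈ Set.Icc 0 S, ∀ α, |w t α| ≤ M) {t : ℝ} (ht : t ∈ Set.Icc 0 S) (α : Fin d → ℤ) :
    w t α = 0 := by
  set N : ℝ := ∑ j, |c j| * (4 / h ^ 2)
  -- Picard iteration: at fixed h the spatial operator is bounded on bounded functions, with norm at
  -- most N, and each integration in time gains a factor Nt/(n+1).
  have key : ∀ n : ℕ, ∀ t ∈ Set.Icc 0 S, ∀ α, |w t α| ≤ M * ((N * t) ^ n / n.factorial) := by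
    intro n
    induction n with
    | zero => simpa using hM
    | succ n ih =>
      intro t ht α
      refine abs_le_of_abs_deriv_le (f := fun t => w t α)
        (g := fun t => M * ((N * t) ^ (n + 1) / (n + 1).factorial))
        (g' := fun t => N * (M * ((N * t) ^ n / n.factorial)))
        ((hc α).mono Set.Icc_subset_Ici_self) (hd α) (fun t => ?_) (h0 α) (by simp)
        (fun t ht => abs_sum_gridForwardDiff_gridBackwardDiff_le (ih t ht) α) t ht
      have h1 : HasDerivAt (fun x : ℝ => N * x) N t := by
        simpa using (hasDerivAt_id t).const_mul N
      refine (((h1.pow (n + 1)).div_const _).const_mul M).congr_deriv ?_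
      rw [Nat.factorial_succ]
      push_cast
      have : (n.factorial : ℝ) ≠ 0 := by positivity
      have : (n : ℝ) + 1 ≠ 0 := by positivity
      field_simp
  have h1 := (FloorSemiring.tendsto_pow_div_factorial_atTop (N * t)).const_mul M
  rw [mul_zero] at h1
  have h2 := ge_of_tendsto' h1 fun n => key n t ht α
  exact abs_nonpos_iff.1 h2

theorem IsSemiDiscreteHeatKernel.eq {c : Fin d → ℝ} {a b : ℝ → (Fin d → ℤ) → ℝ}
    (ha : IsSemiDiscreteHeatKernel h c a) (hb : IsSemiDiscreteHeatKernel h c b) {t : ℝ}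
    (ht : 0 < t) : a t = b t := by
  obtain ⟨A, hA⟩ := ha.bounded t ht
  obtain ⟨B, hB⟩ := hb.bounded t ht
  ext α
  refine sub_eq_zero.1 (eq_zero_of_semiDiscreteHeat (c := c) (h := h) (S := t) (M := A + B)
    (w := fun t α => a t α - b t α) (fun α => ?_) (fun α => ?_) (fun α t ht => ?_)
    (fun t ht α => ?_) ⟨ht.le, le_rfl⟩ α)
  · rw [ha.initial, hb.initial, sub_self]
  · exact (ha.continuousOn α).sub (hb.continuousOn α)
  · refine ((ha.hasDerivAt α t ht).sub (hb.hasDerivAt α t ht)).congr_deriv ?_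
    rw [← Finset.sum_sub_distrib]
    refine Finset.sum_congr rfl fun j _ => ?_
    simp only [gridForwardDiff_gridBackwardDiff]
    ring
  · exact (abs_sub _ _).trans (add_le_add (hA t ht α) (hB t ht α))

end gridKernel

/-! ### Domination of the error kernel by the majorant. -/

section errorKernel
variable {d : ℕ} {h lam Lam L : ℝ} {c : (Fin d → ℤ) → Fin d → ℝ}

/-- Passing to the ℓ¹ norm splits the distance into weights that each involve a single coordinate,
hence a single factor of the product kernel. -/
theorem dist_gridPoint_le (α β : Fin d → ℤ) :
    dist (gridPoint h α) (gridPoint h β) ≤ ∑ l, |((α - β) l : ℝ) * h| := by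
  rw [EuclideanSpace.dist_eq]
  refine Real.sqrt_le_iff.2 ⟨Finset.sum_nonneg fun _ _ => abs_nonneg _, ?_⟩
  calc ∑ l, dist (gridPoint h α l) (gridPoint h β l) ^ 2 = ∑ l, |((α - β) l : ℝ) * h| ^ 2 := by
        refine Finset.sum_congr rfl fun l _ => ?_
        simp only [gridPoint, Real.dist_eq, Pi.sub_apply]
        push_cast
        rw [sub_mul]
    _ ≤ _ := Finset.sum_sq_le_sq_sum_of_nonneg fun _ _ => abs_nonneg _

theorem AdmissibleCoeff.abs_sub_le (hc : AdmissibleCoeff h lam Lam L c)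
    (α β : Fin d → ℤ) (j : Fin d) :
    |c α j - c β j| ≤ |L| * ∑ l, |((α - β) l : ℝ) * h| :=
  (hc.lipschitz α β j).trans (mul_le_mul (le_abs_self L) (dist_gridPoint_le α β) dist_nonneg
    (abs_nonneg L))

theorem AdmissibleCoeff.le_coeffSup (hc : AdmissibleCoeff h lam Lam L c) (α : Fin d → ℤ)
    (j : Fin d) : c α j ≤ coeffSup c :=
  le_ciSup (f := fun p : (Fin d → ℤ) × Fin d => c p.1 p.2)
    ⟨Lam, by rintro _ ⟨p, rfl⟩; exact hc.upper p.1 p.2⟩ (α, j)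

theorem AdmissibleCoeff.coeffSup_le (hd : 1 ≤ d) (hc : AdmissibleCoeff h lam Lam L c) :
    coeffSup c ≤ Lam := by
  have : Nonempty (Fin d) := ⟨⟨0, hd⟩⟩
  exact ciSup_le fun p => hc.upper p.1 p.2

theorem AdmissibleCoeff.le_coeffSup_of_lower (hd : 1 ≤ d) (hc : AdmissibleCoeff h lam Lam L c) :
    lam ≤ coeffSup c :=
  (hc.lower 0 ⟨0, hd⟩).trans (hc.le_coeffSup 0 ⟨0, hd⟩)

theorem errorKernel_eq {a : ℝ → (Fin d → ℤ) → (Fin d → ℤ) → ℝ} (t : ℝ) (α β : Fin d → ℤ) :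
    errorKernel h c a t α β = ∑ j, (c α j - c β j) *
      gridForwardDiff h j (gridBackwardDiff h j fun γ => a t γ β) (α - β) := by
  unfold errorKernel
  refine Finset.sum_congr rfl fun j _ => ?_
  simp only [gridForwardDiff_gridBackwardDiff]
  rw [show α + Pi.single j 1 - β = α - β + Pi.single j 1 by abel,
    show α - Pi.single j 1 - β = α - β - Pi.single j 1 by abel]

theorem aemeasurable_errorKernel {a : ℝ → (Fin d → ℤ) → (Fin d → ℤ) → ℝ}
    (ha : IsFrozenHeatKernel h c a) (T : ℝ) (α β : Fin d → ℤ) :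
    AEMeasurable (fun t => errorKernel h c a t α β) (volume.restrict (Set.Ioc 0 T)) := by
  have hcont : ∀ γ, ContinuousOn (fun t => a t γ β) (Set.Ioc 0 T) := fun γ =>
    ((ha β).continuousOn γ).mono (Set.Ioc_subset_Ioi_self.trans Set.Ioi_subset_Ici_self)
  refine ContinuousOn.aemeasurable ?_ measurableSet_Ioc
  simp only [errorKernel_eq, gridForwardDiff_gridBackwardDiff]
  refine continuousOn_finsetSum _ fun j _ => continuousOn_const.mul ?_
  exact (((hcont _).sub (continuousOn_const.mul (hcont _))).add (hcont _)).div_const _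

/-- The frozen times τ = c_β^j t differ between coordinates. They are replaced by the common time
C₁t at the cost of the ratio 2Λ/λ, and powers of τ become powers of t at the cost of R. -/
theorem exists_scaled_lineKernel_bounds {Lam : ℝ} (hlam : 0 < lam) (hLam : lam ≤ Lam) :
    ∃ A : ℝ, 0 < A ∧ ∀ h t τ C₁ : ℝ, 0 < h → 0 < t → lam * t ≤ τ → τ ≤ Lam * t →
      τ ≤ C₁ * t → C₁ ≤ 2 * Lam → ∀ k : ℤ,
      |h⁻¹ * lineKernel (τ / h ^ 2) k| ≤ A * lorentzCell h (C₁ * t) k ∧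
      |(k : ℝ) * h| * |h⁻¹ * lineKernel (τ / h ^ 2) k| ≤
        A * lorentzCell h (C₁ * t) k * √t ∧
      |h⁻¹ * lineKernelLap (τ / h ^ 2) k / h ^ 2| ≤ A * lorentzCell h (C₁ * t) k * (1 / t) ∧
      |(k : ℝ) * h| * |h⁻¹ * lineKernelLap (τ / h ^ 2) k / h ^ 2| ≤
        A * lorentzCell h (C₁ * t) k * (1 / t * √t) := by
  obtain ⟨A, hA0, hA⟩ := exists_lineKernel_bounds
  have hLam0 : 0 < Lam := hlam.trans_le hLam
  have hsl : 0 < √lam := Real.sqrt_pos.2 hlam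
  have hsL : 0 < √Lam := Real.sqrt_pos.2 hLam0
  set r : ℝ := 2 * Lam / lam
  set R : ℝ := 1 + √Lam + 1 / lam + 1 / √lam
  have hr : 0 < r := by positivity
  have hR : 0 < R := by positivity
  have q1 : 0 < 1 / lam := by positivity
  have q2 : 0 < 1 / √lam := by positivity
  refine ⟨A * r * R, by positivity, fun h t τ C₁ hh ht hl hu hC hC2 k => ?_⟩
  have hτ : 0 < τ := (mul_pos hlam ht).trans_le hl
  have hst : 0 < √t := Real.sqrt_pos.2 ht
  obtain ⟨b1, b2, b3, b4⟩ := hA h τ hh hτ k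
  have hmono : lorentzCell h τ k ≤ r * lorentzCell h (C₁ * t) k := by
    refine lorentzCell_mono_time hh hτ hC ?_ k
    calc C₁ * t ≤ 2 * Lam * t := by gcongr
      _ = r * (lam * t) := by simp only [r]; field_simp
      _ ≤ r * τ := by gcongr
  set G := lorentzCell h (C₁ * t) k
  have hG : 0 < G := lorentzCell_pos hh (hτ.trans_le hC) k
  have hG' : 0 < lorentzCell h τ k := lorentzCell_pos hh hτ k
  have main : ∀ x y X : ℝ, 0 ≤ x → 0 ≤ y → x ≤ R * y → X ≤ A * x * lorentzCell h τ k →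
      X ≤ A * r * R * G * y := by
    intro x y X hx hy hxy hX
    calc X ≤ A * x * lorentzCell h τ k := hX
      _ ≤ A * (R * y) * (r * G) := by gcongr
      _ = _ := by ring
  have hsτ : √τ ≤ √Lam * √t := by
    rw [← Real.sqrt_mul hLam0.le]; exact Real.sqrt_le_sqrt hu
  have hsτ' : √lam * √t ≤ √τ := by
    rw [← Real.sqrt_mul hlam.le]; exact Real.sqrt_le_sqrt hl
  refine ⟨?_, ?_, ?_, ?_⟩
  · have := main 1 1 _ zero_le_one zero_le_one (by simp only [R]; linarith) (by simpa using b1)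
    simpa using this
  · refine main √τ √t _ (by positivity) hst.le (hsτ.trans ?_) b2
    gcongr
    simp only [R]; linarith
  · refine main (1 / τ) (1 / t) _ (by positivity) (by positivity) ?_ (by rwa [mul_one_div])
    calc 1 / τ ≤ 1 / (lam * t) := by gcongr
      _ = 1 / lam * (1 / t) := by field_simp
      _ ≤ R * (1 / t) := by gcongr; simp only [R]; linarith
  · have e : 1 / t * √t = 1 / √t := by
      rw [one_div_mul_eq_div, Real.sqrt_div_self']
    rw [e]
    refine main (1 / √τ) (1 / √t) _ (by positivity) (by positivity) ?_ (by rwa [mul_one_div])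
    calc 1 / √τ ≤ 1 / (√lam * √t) := by gcongr
      _ = 1 / √lam * (1 / √t) := by field_simp
      _ ≤ R * (1 / √t) := by gcongr; simp only [R]; linarith

/-- Distributes the weight in coordinate l and the Laplacian in coordinate j over one product; when
j = l both fall on the same factor. -/
theorem prod_erase_mul_mul {ι : Type*} [Fintype ι] [DecidableEq ι] (p x : ι → ℝ) (q : ℝ)
    (j l : ι) : x l * ((∏ i ∈ Finset.univ.erase j, p i) * q) =
      ∏ i, (if i = l then x i else 1) * (if i = j then q else p i) := by
  rw [Finset.prod_mul_distrib, Finset.prod_ite_eq' Finset.univ l x, if_pos (Finset.mem_univ l),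
    ← Finset.prod_erase_mul (f := fun i => if i = j then q else p i) _ (Finset.mem_univ j),
    if_pos rfl]
  congr 2
  exact Finset.prod_congr rfl fun i hi => (if_neg (Finset.ne_of_mem_erase hi)).symm

/-- Each of the d² pairs (j, l) contributes a Laplacian factor 1/t and a distance factor √t, that is
t^(-1/2), times A^d and the product of cells. -/
theorem exists_errorKernel_bound (hd : 1 ≤ d) (hlam : 0 < lam) (Lam L : ℝ) :
    ∃ C : ℝ, 0 < C ∧ ∀ h : ℝ, 0 < h → ∀ c : (Fin d → ℤ) → Fin d → ℝ,
      AdmissibleCoeff h lam Lam L c → ∀ a, IsFrozenHeatKernel h c a →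
      ∀ T, LorentzBounded h T (2 * coeffSup c) C (1 / 2) (errorKernel h c a) := by
  -- The maximum replaces Λ because λ ≤ Λ is not assumed at this point.
  obtain ⟨A, hA0, hA⟩ := exists_scaled_lineKernel_bounds hlam (le_max_right Lam lam)
  refine ⟨1 + d * d * |L| * A ^ d, by positivity, fun h hh c hc a ha T =>
    ⟨aemeasurable_errorKernel ha T, fun t ht α β => ?_⟩⟩
  have ht0 := ht.1
  have hsup := hc.coeffSup_le hd
  have hsup0 : 0 < coeffSup c := hlam.trans_le (hc.le_coeffSup_of_lower hd)
  have hst : 0 < √t := Real.sqrt_pos.2 ht0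
  set G := lorentzProd h (2 * coeffSup c * t) (α - β) with hG
  have hG0 : 0 < G := lorentzProd_pos hh (by positivity) _
  have hb := fun i : Fin d => hA h t (c β i * t) (2 * coeffSup c) hh ht0
    (by have := hc.lower β i; gcongr)
    (by have := (hc.upper β i).trans (le_max_left Lam lam); gcongr)
    (by have := hc.le_coeffSup β i; gcongr; linarith)
    (by have := le_max_left Lam lam; linarith) ((α - β) i)
  set p : Fin d → ℝ := fun i => |h⁻¹ * lineKernel (c β i * t / h ^ 2) ((α - β) i)| with hp
  set q : Fin d → ℝ := fun i => |h⁻¹ * lineKernelLap (c β i * t / h ^ 2) ((α - β) i) / h ^ 2|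
    with hq
  set x : Fin d → ℝ := fun l => |((α - β) l : ℝ) * h| with hx
  have hterm : ∀ j l, x l * ((∏ i ∈ Finset.univ.erase j, p i) * q j) ≤
      A ^ d * (1 / t * √t) * G := by
    intro j l
    rw [prod_erase_mul_mul]
    calc _ ≤ ∏ i, (A * lorentzCell h (2 * coeffSup c * t) ((α - β) i) *
          ((if i = j then 1 / t else 1) * (if i = l then √t else 1))) := by
          refine Finset.prod_le_prod (fun i _ => ?_) fun i _ => ?_
          · refine mul_nonneg ?_ ?_ <;> split_ifs
            exacts [abs_nonneg _, zero_le_one, abs_nonneg _, abs_nonneg _]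
          · obtain ⟨b1, b2, b3, b4⟩ := hb i
            rcases eq_or_ne i j with rfl | hij
            · rw [if_pos rfl, if_pos rfl]
              split_ifs
              · exact b4
              · rw [one_mul, mul_one]; exact b3
            · rw [if_neg hij, if_neg hij]
              split_ifs
              · rw [one_mul]; exact b2
              · rw [one_mul, mul_one, mul_one]; exact b1
      _ = _ := by
          rw [Finset.prod_mul_distrib, Finset.prod_mul_distrib, Finset.prod_mul_distrib,
            Finset.prod_ite_eq' Finset.univ l, Finset.prod_ite_eq' Finset.univ j,
            if_pos (Finset.mem_univ _), if_pos (Finset.mem_univ _), Finset.prod_const,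
            Finset.card_univ, Fintype.card_fin, hG, lorentzProd]
          ring
  have hpow : t ^ ((1 / 2 : ℝ) - 1) = 1 / t * √t := by
    rw [Real.rpow_sub_one ht0.ne', ← Real.sqrt_eq_rpow]; ring
  rw [errorKernel_eq, hpow]
  -- Uniqueness is what makes the bound available for every frozen kernel a.
  have hker : (fun γ => a t γ β) = gridKernel h (c β) t :=
    (ha β).eq (isSemiDiscreteHeatKernel_gridKernel hh fun j => hlam.le.trans (hc.lower β j)) ht0
  rw [hker]
  calc _ ≤ ∑ j, |(c α j - c β j) * gridForwardDiff h j
        (gridBackwardDiff h j (gridKernel h (c β) t)) (α - β)| := Finset.abs_sum_le_sum_abs _ _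
    _ ≤ ∑ _j : Fin d, |L| * (d * (A ^ d * (1 / t * √t) * G)) := by
        refine Finset.sum_le_sum fun j _ => ?_
        rw [abs_mul, gridForwardDiff_gridBackwardDiff_gridKernel, abs_mul, Finset.abs_prod]
        calc _ ≤ (|L| * ∑ l, x l) * ((∏ i ∈ Finset.univ.erase j, p i) * q j) := by
              refine mul_le_mul_of_nonneg_right (hc.abs_sub_le α β j) ?_
              exact mul_nonneg (Finset.prod_nonneg fun _ _ => abs_nonneg _) (abs_nonneg _)
          _ = |L| * ∑ l, x l * ((∏ i ∈ Finset.univ.erase j, p i) * q j) := by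
              rw [mul_assoc, Finset.sum_mul]
          _ ≤ |L| * ∑ _l : Fin d, A ^ d * (1 / t * √t) * G := by
              exact mul_le_mul_of_nonneg_left (Finset.sum_le_sum fun l _ => hterm j l)
                (abs_nonneg _)
          _ = _ := by simp
    _ = d * d * |L| * A ^ d * (1 / t * √t) * G := by
        rw [Finset.sum_const, Finset.card_univ, Fintype.card_fin, nsmul_eq_mul]; ring
    _ ≤ _ := by
        gcongr
        linarith

/-- On the diagonal the two forms agree up to a factor at least 1; off it the left side carries an
extra 1/√C₁ ≤ 1/√m. The constant 1 + 1/√m covers both. -/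
theorem lorentzCell_le_parametrix {C₁ t m : ℝ} (hh : 0 < h) (hm : 0 < m) (hC : m ≤ C₁)
    (ht : 0 < t) (k : ℤ) :
    lorentzCell h (C₁ * t) k ≤ (1 + 1 / √m) *
      ((if k = 0 then min (1 / √C₁) (√t / h) else 1) *
        (t ^ (-(1 / 2) : ℝ) * (1 + ((k : ℝ) * h) ^ 2 / (C₁ * t))⁻¹)) := by
  have hC0 : 0 < C₁ := hm.trans_le hC
  have hsm : 0 < √m := Real.sqrt_pos.2 hm
  have hsC : 0 < √C₁ := Real.sqrt_pos.2 hC0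
  have hst : 0 < √t := Real.sqrt_pos.2 ht
  have hpow : t ^ (-(1 / 2) : ℝ) = 1 / √t := by
    rw [Real.rpow_neg ht.le, ← Real.sqrt_eq_rpow, one_div]
  have hκ : 1 / √C₁ ≤ 1 + 1 / √m := by
    have h1 : 1 / √C₁ ≤ 1 / √m := by gcongr
    linarith
  have hκ1 : 1 ≤ 1 + 1 / √m := by
    have : 0 < 1 / √m := by positivity
    linarith
  rw [hpow]
  by_cases hk : k = 0
  · subst hk
    rw [lorentzCell_zero, if_pos rfl, Real.sqrt_mul hC0.le]
    have e : min (1 / (√C₁ * √t)) (1 / h) = min (1 / √C₁) (√t / h) * (1 / √t) := by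
      rw [min_mul_of_nonneg _ _ (by positivity)]
      congr 1 <;> field_simp
    rw [e]
    simp only [Int.cast_zero, zero_mul, ne_eq, OfNat.ofNat_ne_zero, not_false_eq_true, zero_pow,
      zero_div, add_zero, inv_one, mul_one]
    exact le_mul_of_one_le_left (by positivity) hκ1
  · rw [if_neg hk, one_mul, lorentzCell_of_ne hk, ← lorentzian_eq_div (by positivity), lorentzian,
      Real.sqrt_mul hC0.le]
    calc _ = 1 / √C₁ * (1 / √t * (1 + ((k : ℝ) * h) ^ 2 / (C₁ * t))⁻¹) := by
          field_simp
      _ ≤ _ := by gcongr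

theorem lorentzMajorant_le_parametrix {C₁ t m : ℝ} (hh : 0 < h) (hm : 0 < m) (hC : m ≤ C₁)
    (ht : 0 < t) (α β : Fin d → ℤ) :
    lorentzMajorant C₁ h t (α - β) ≤ (1 + 1 / √m) ^ d *
      ((min (1 / √C₁) (√t / h)) ^ zeroCount (α - β) * t ^ (-((d : ℝ) + 1) / 2) *
        ∏ j, (1 + |gridPoint h α j - gridPoint h β j| ^ 2 / (C₁ * t))⁻¹) := by
  have hC0 : 0 < C₁ := hm.trans_le hC
  rw [lorentzMajorant_eq hC0 hh ht]
  have h1 : lorentzProd h (C₁ * t) (α - β) ≤ ∏ j, ((1 + 1 / √m) *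
      ((if (α - β) j = 0 then min (1 / √C₁) (√t / h) else 1) *
        (t ^ (-(1 / 2) : ℝ) * (1 + (((α - β) j : ℝ) * h) ^ 2 / (C₁ * t))⁻¹))) :=
    Finset.prod_le_prod (fun j _ => (lorentzCell_pos hh (mul_pos hC0 ht) _).le)
      fun j _ => lorentzCell_le_parametrix hh hm hC ht _
  rw [Finset.prod_mul_distrib, ← pow_zeroCount_mul_prod, Finset.prod_mul_distrib,
    Finset.prod_const, Finset.prod_const, Finset.card_univ, Fintype.card_fin] at h1
  have h2 : t ^ (-((d : ℝ) + 1) / 2) = t ^ (-(1 / 2) : ℝ) * (t ^ (-(1 / 2) : ℝ)) ^ d := by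
    rw [← Real.rpow_natCast, ← Real.rpow_mul ht.le, ← Real.rpow_add ht]
    congr 1; ring
  have h3 : ∀ j, |gridPoint h α j - gridPoint h β j| ^ 2 = (((α - β) j : ℝ) * h) ^ 2 := by
    intro j
    rw [sq_abs]
    simp only [gridPoint, Pi.sub_apply]
    push_cast
    ring
  simp only [h2, h3]
  refine (mul_le_mul_of_nonneg_left h1 (Real.rpow_nonneg ht.le _)).trans_eq ?_
  ring

end errorKernel

end

/-! ### Assembly of the results. -/

theorem mainTheorem1 (d : ℕ) (hd : 1 ≤ d) :
    -- bounds for the iterated kernels of any kernel dominated by the Lorentzian majorant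
    (∀ C C₁ : ℝ, 0 < C → 0 < C₁ → ∃ C₃ : ℝ, 0 < C₃ ∧
      ∀ Δx T : ℝ, 0 < Δx → 0 < T → ∀ K : ℝ → (Fin d → ℤ) → (Fin d → ℤ) → ℝ,
        (∀ α β, AEMeasurable (fun t => K t α β) (volume.restrict (Set.Ioc 0 T))) →
        (∀ t ∈ Set.Ioc 0 T, ∀ α β, |K t α β| ≤ C * lorentzMajorant C₁ Δx t (α - β)) →
        IterKernelWellDefined Δx T K ∧
        ∀ m : ℕ, 1 ≤ m → ∀ t ∈ Set.Ioc 0 T, ∀ α β,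
          |iterKernel Δx K m t α β| ≤
            C * C₃ ^ m / Real.Gamma ((m : ℝ) / 2) * t ^ (((m : ℝ) - 1) / 2) *
              lorentzMajorant C₁ Δx t (α - β)) ∧
    -- convergence and bound of the Neumann series of any such kernel
    (∀ C C₁ T : ℝ, 0 < C → 0 < C₁ → 0 < T → ∃ B : ℝ, 0 < B ∧
      ∀ Δx : ℝ, 0 < Δx → ∀ K : ℝ → (Fin d → ℤ) → (Fin d → ℤ) → ℝ,
        (∀ α β, AEMeasurable (fun t => K t α β) (volume.restrict (Set.Ioc 0 T))) →
        (∀ t ∈ Set.Ioc 0 T, ∀ α β, |K t α β| ≤ C * lorentzMajorant C₁ Δx t (α - β)) →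
        NeumannSeriesConverges Δx T K ∧
        ∀ t ∈ Set.Ioc 0 T, ∀ α β,
          |neumannSum Δx K t α β| ≤ B * lorentzMajorant C₁ Δx t (α - β)) ∧
    -- existence of the frozen-coefficient heat kernels
    (∀ lam Lam L Δx : ℝ, 0 < lam → 0 < Δx → ∀ c : (Fin d → ℤ) → Fin d → ℝ,
      AdmissibleCoeff Δx lam Lam L c → ∃ a, IsFrozenHeatKernel Δx c a) ∧
    -- bounds for the iterated frozen-coefficient error kernels, uniform in the grid size
    (∀ lam Lam L : ℝ, 0 < lam → ∃ C C₃ : ℝ, 0 < C ∧ 0 < C₃ ∧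
      ∀ Δx : ℝ, 0 < Δx → ∀ c : (Fin d → ℤ) → Fin d → ℝ, AdmissibleCoeff Δx lam Lam L c →
      ∀ a, IsFrozenHeatKernel Δx c a →
        (∀ T : ℝ, 0 < T → IterKernelWellDefined Δx T (errorKernel Δx c a)) ∧
        ∀ m : ℕ, 1 ≤ m → ∀ t : ℝ, 0 < t → ∀ α β,
          |iterKernel Δx (errorKernel Δx c a) m t α β| ≤
            C * C₃ ^ m / Real.Gamma ((m : ℝ) / 2) * t ^ (((m : ℝ) - 1) / 2) *
              lorentzMajorant (2 * coeffSup c) Δx t (α - β)) ∧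
    -- convergence and bound of the parametrix Neumann series, uniform in the grid size
    (∀ lam Lam L T : ℝ, 0 < lam → 0 < T → ∃ B : ℝ, 0 < B ∧
      ∀ Δx : ℝ, 0 < Δx → ∀ c : (Fin d → ℤ) → Fin d → ℝ, AdmissibleCoeff Δx lam Lam L c →
      ∀ a, IsFrozenHeatKernel Δx c a →
        NeumannSeriesConverges Δx T (errorKernel Δx c a) ∧
        ∀ t ∈ Set.Ioc 0 T, ∀ α β,
          |neumannSum Δx (errorKernel Δx c a) t α β| ≤
            B * (min (1 / √(2 * coeffSup c)) (√t / Δx)) ^ zeroCount (α - β) *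
              t ^ (-((d : ℝ) + 1) / 2) *
              ∏ j, (1 + |gridPoint Δx α j - gridPoint Δx β j| ^ 2 /
                (2 * coeffSup c * t))⁻¹) := by
  refine ⟨fun C C₁ hC hC₁ => ⟨iterRate d C, iterRate_pos d C, fun h T hh _ K hm hb => ?_⟩,
    fun C C₁ T hC hC₁ hT => ⟨neumannBound d C T, neumannBound_pos hC.le hT,
      fun h hh K hm hb => ?_⟩,
    fun lam Lam L h hlam hh c hc => ⟨fun t α β => gridKernel h (c β) t α, fun β =>
      isSemiDiscreteHeatKernel_gridKernel hh fun j => hlam.le.trans (hc.lower β j)⟩,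
    fun lam Lam L hlam => ?_, fun lam Lam L T hlam hT => ?_⟩
  · have hK := LorentzBounded.of_lorentzMajorant hh hC₁ hm hb
    exact ⟨iterKernelWellDefined hh hC₁ hC.le hK,
      fun m hm t ht α β => abs_iterKernel_le hh hC₁ hC.le hK hm ht α β⟩
  · have hK := LorentzBounded.of_lorentzMajorant hh hC₁ hm hb
    exact ⟨neumannSeriesConverges hh hC₁ hC.le hT hK,
      fun t ht α β => abs_neumannSum_le hh hC₁ hC.le hK ht α β⟩
  · obtain ⟨C, hC, hE⟩ := exists_errorKernel_bound hd hlam Lam L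
    refine ⟨C, iterRate d C, hC, iterRate_pos d C, fun h hh c hc a ha => ?_⟩
    have hC₁ : 0 < 2 * coeffSup c := by linarith [hc.le_coeffSup_of_lower hd]
    -- The constant of the error kernel does not depend on T, so T = t may be taken in the pointwise
    -- bound.
    exact ⟨fun T _ => iterKernelWellDefined hh hC₁ hC.le (hE h hh c hc a ha T),
      fun m hm t ht α β =>
        abs_iterKernel_le hh hC₁ hC.le (hE h hh c hc a ha t) hm ⟨ht, le_rfl⟩ α β⟩
  · obtain ⟨C, hC, hE⟩ := exists_errorKernel_bound hd hlam Lam L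
    have hB := neumannBound_pos (d := d) hC.le hT
    -- Each coordinate costs 1 + 1/√(2λ) in the passage to the explicit form, since 2c̄ ≥ 2λ.
    refine ⟨neumannBound d C T * (1 + 1 / √(2 * lam)) ^ d, by positivity,
      fun h hh c hc a ha => ?_⟩
    have hsup : 2 * lam ≤ 2 * coeffSup c := by linarith [hc.le_coeffSup_of_lower hd]
    have hC₁ : 0 < 2 * coeffSup c := by linarith
    have hK := hE h hh c hc a ha T
    refine ⟨neumannSeriesConverges hh hC₁ hC.le hT hK, fun t ht α β => ?_⟩
    refine (abs_neumannSum_le hh hC₁ hC.le hK ht α β).trans ?_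
    refine (mul_le_mul_of_nonneg_left
      (lorentzMajorant_le_parametrix hh (by positivity : 0 < 2 * lam) hsup ht.1 α β)
      hB.le).trans_eq ?_
    ring
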